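/- Let $n,m\in\mathbb N$ with $m+1>n+3$ (here $m$ is the number of sampled columns and $T=m+1$ the number of time steps, so the condition is $T>n+3$; in particular it holds if $m>n+3$). Let $\Sigma\in\mathbb R^{n\times n}$ be positive definite and let $X$ be a random $n\times m$ real matrix whose columns are independent with law $\mathcal N_n(0,\Sigma)$. Let $X^\dagger$ be the Moore–Penrose pseudo-inverse of $X$, an $m\times n$ matrix. Then: (a) $S=XX'$ has the Wishart distribution $W_n(\Sigma,m)$, i.e. the law of $\sum_{k=1}^m g_kg_k'$ for independent $g_k\sim\mathcal N_n(0,\Sigma)$. (b) For all $1\le i\le m$ and $1\le j\le n$, the variables $X^\dagger_{ij}$ and $(X^\dagger_{ij})^2$ are integrable, and $$\mathbb E[X^\dagger_{ij}]=0,\qquad \mathbb E[(X^\dagger_{ij})^2]=\frac{(\Sigma^{-1})_{jj}}{m(m-n-1)}.$$ (c) If moreover $\Sigma$ is diagonal, $\Sigma=\mathrm{diag}(\sigma_1^2,\dots,\sigma_n^2)$, and $\sigma_{ij}^2$ denotes the variance of $X_{ji}$, the $j$-th coordinate of the $i$-th sample (so $\sigma_{ij}^2=\sigma_j^2$), then $$\mathbb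 E[(X^\dagger_{ij})^2]=\frac{1}{\sigma_{ij}^2\,m(m-n-1)}.$$ -/

import Mathlib

open MeasureTheory ProbabilityTheory Matrix

/-- The four Penrose conditions: `B` is a Moore–Penrose pseudo-inverse of the real matrix `A`. -/
structure IsMoorePenrose {p q : ℕ} (A : Matrix (Fin p) (Fin q) ℝ)
    (B : Matrix (Fin q) (Fin p) ℝ) : Prop where
  mul_mul_left : A * B * A = A
  mul_mul_right : B * A * B = B
  symm_left : (A * B)ᵀ = A * B
  symm_right : (B * A)ᵀ = B * A

/-- The four Penrose conditions have at most one solution. -/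
theorem IsMoorePenrose.unique {p q : ℕ} {A : Matrix (Fin p) (Fin q) ℝ}
    {B C : Matrix (Fin q) (Fin p) ℝ} (hB : IsMoorePenrose A B) (hC : IsMoorePenrose A C) :
    B = C := by
  have h1 : A * B = A * C := by
    calc A * B = (A * C * A) * B := by rw [hC.mul_mul_left]
      _ = (A * C) * (A * B) := by rw [Matrix.mul_assoc (A * C)]
      _ = (A * C)ᵀ * (A * B)ᵀ := by rw [hC.symm_left, hB.symm_left]
      _ = ((A * B * A) * C)ᵀ := by rw [← Matrix.transpose_mul, ← Matrix.mul_assoc]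
      _ = A * C := by rw [hB.mul_mul_left, hC.symm_left]
  have h2 : B * A = C * A := by
    calc B * A = B * (A * C * A) := by rw [hC.mul_mul_left]
      _ = (B * A) * (C * A) := by simp only [Matrix.mul_assoc]
      _ = (B * A)ᵀ * (C * A)ᵀ := by rw [hB.symm_right, hC.symm_right]
      _ = (C * (A * B * A))ᵀ := by rw [← Matrix.transpose_mul]; simp only [Matrix.mul_assoc]
      _ = C * A := by rw [hB.mul_mul_left, hC.symm_right]
  calc B = B * A * B := hB.mul_mul_right.symm
    _ = C * A * B := by rw [h2]
    _ = C * (A * B) := Matrix.mul_assoc _ _ _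
    _ = C * A * C := by rw [h1, Matrix.mul_assoc]
    _ = C := hC.mul_mul_right

/-- Every real matrix has a Moore–Penrose pseudo-inverse. -/
theorem exists_isMoorePenrose {p q : ℕ} (A : Matrix (Fin p) (Fin q) ℝ) :
    ∃ B, IsMoorePenrose A B := by
  obtain ⟨H, hHs, h1, h2, h3⟩ : ∃ H : Matrix (Fin q) (Fin q) ℝ, Hᵀ = H ∧
      (Aᵀ * A) * H * (Aᵀ * A) = Aᵀ * A ∧ H * (Aᵀ * A) * H = H ∧
      (H * (Aᵀ * A)) = (Aᵀ * A) * H := by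
    have hG : (Aᵀ * A).IsHermitian := by
      simpa [conjTranspose_eq_transpose_of_trivial] using
        Matrix.isHermitian_conjTranspose_mul_self A
    set U : Matrix (Fin q) (Fin q) ℝ := hG.eigenvectorUnitary.1 with hU
    set d := hG.eigenvalues
    have hUU : Uᵀ * U = 1 := by
      have := Unitary.coe_star_mul_self hG.eigenvectorUnitary
      rwa [star_eq_conjTranspose, conjTranspose_eq_transpose_of_trivial] at this
    have hsp : Aᵀ * A = U * diagonal d * Uᵀ := by
      have := hG.spectral_theorem
      rw [Unitary.conjStarAlgAut_apply] at this
      rw [this]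
      rfl
    have key : ∀ e f : Fin q → ℝ, (U * diagonal e * Uᵀ) * (U * diagonal f * Uᵀ)
        = U * diagonal (fun i => e i * f i) * Uᵀ := by
      intro e f
      calc _ = U * diagonal e * (Uᵀ * U) * diagonal f * Uᵀ := by simp only [Matrix.mul_assoc]
        _ = _ := by rw [hUU, Matrix.mul_one, Matrix.mul_assoc U, diagonal_mul_diagonal]
    refine ⟨U * diagonal (fun i => (d i)⁻¹) * Uᵀ, ?_, ?_, ?_, ?_⟩
    · simp [Matrix.transpose_mul, Matrix.mul_assoc]
    · rw [hsp, key, key]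
      simp
    · rw [hsp, key, key]
      congr 3
      funext i
      by_cases h : d i = 0 <;> simp [h]
    · rw [hsp, key, key]
      simp [mul_comm]
  have hA : A * (H * (Aᵀ * A)) = A := by
    have hz : (A * (H * (Aᵀ * A)) - A)ᴴ * (A * (H * (Aᵀ * A)) - A) = 0 := by
      have e : (A * (H * (Aᵀ * A)) - A)ᵀ = (Aᵀ * A) * H * Aᵀ - Aᵀ := by
        simp [Matrix.transpose_mul, hHs, Matrix.mul_assoc]
      rw [conjTranspose_eq_transpose_of_trivial, e]
      have e2 : ((Aᵀ * A) * H * Aᵀ - Aᵀ) * (A * (H * (Aᵀ * A)) - A)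
          = (Aᵀ * A * H * (Aᵀ * A)) * H * (Aᵀ * A) - (Aᵀ * A * H * (Aᵀ * A))
            - (Aᵀ * A * H * (Aᵀ * A)) + Aᵀ * A := by
        simp only [Matrix.sub_mul, Matrix.mul_sub, Matrix.mul_assoc]
        abel
      rw [e2, h1, h1]
      simp
    exact sub_eq_zero.1 (conjTranspose_mul_self_eq_zero.1 hz)
  refine ⟨H * Aᵀ, ?_, ?_, ?_, ?_⟩
  · calc A * (H * Aᵀ) * A = A * (H * (Aᵀ * A)) := by simp only [Matrix.mul_assoc]
      _ = A := hA
  · calc H * Aᵀ * A * (H * Aᵀ) = (H * (Aᵀ * A) * H) * Aᵀ := by simp only [Matrix.mul_assoc]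
      _ = H * Aᵀ := by rw [h2]
  · simp [Matrix.transpose_mul, hHs, Matrix.mul_assoc]
  · calc (H * Aᵀ * A)ᵀ = (Aᵀ * A) * H := by simp [Matrix.transpose_mul, hHs, Matrix.mul_assoc]
      _ = H * Aᵀ * A := by rw [← h3, Matrix.mul_assoc]

/-- The Moore–Penrose pseudo-inverse `A†` of a real matrix `A`. -/
noncomputable def moorePenrose {p q : ℕ} (A : Matrix (Fin p) (Fin q) ℝ) :
    Matrix (Fin q) (Fin p) ℝ :=
  (exists_isMoorePenrose A).choose

theorem moorePenrose_spec {p q : ℕ} (A : Matrix (Fin p) (Fin q) ℝ) :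
    IsMoorePenrose A (moorePenrose A) :=
  (exists_isMoorePenrose A).choose_spec

/-- The `k`-th column of a matrix, as a vector of Euclidean space. -/
def euclideanCol {n m : ℕ} (A : Matrix (Fin n) (Fin m) ℝ) (k : Fin m) :
    EuclideanSpace ℝ (Fin n) :=
  WithLp.toLp 2 (fun i => A i k)

/-- The Wishart distribution `W_n(S, m)` with scale matrix `S` and `m` degrees of freedom: the law
of `∑ k, g_k g_kᵀ` where `g_1, …, g_m` are independent `N_n(0, S)` vectors. It is a measure on
`n × n` arrays, with the product σ-algebra. -/
noncomputable def wishart {n : ℕ} (S : Matrix (Fin n) (Fin n) ℝ) (m : ℕ) :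
    Measure (Fin n → Fin n → ℝ) :=
  (Measure.pi (fun _ : Fin m => multivariateGaussian (0 : EuclideanSpace ℝ (Fin n)) S)).map
    (fun g a b => ∑ k, g k a * g k b)

/-! Columns with covariance `S = Q Qᵀ` are the images under `Q` of standard Gaussian columns, so that
`X = Q Yᵀ` for an `m × n` array `Y` of independent standard normal variables whose rows are the
samples. Almost surely `XXᵀ` is invertible and `X† = Xᵀ(XXᵀ)⁻¹`, which makes `X†ᵢⱼ` the `i`-th
coordinate of `Y W⁻¹ u` with `W = YᵀY` and `u = Q⁻¹ eⱼ`; note `|u|² = (S⁻¹)ⱼⱼ`. This coordinate is odd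
in `Y`, hence centred. The squares of the `m` coordinates add up to `uᵀ W⁻¹ u` and are exchangeable,
so everything reduces to the mean of the inverse Wishart law, `E[uᵀ W⁻¹ u] = |u|² / (m - n - 1)`.

That mean is obtained by Gaussian integration by parts. To avoid the singularity of `W⁻¹`, work with
`R = (ε + W)⁻¹`, for which `Y R` and its partial derivatives are bounded. Stein's identity in every
entry of `Y`, together with `W R = 1 - ε R`, gives `integral_ridgeInv`:
`E[(m - n - 1) R + ε tr(R) R + ε R² + ε R] = 1`.
All terms are nonnegative as quadratic forms, so `E[uᵀ R u] ≤ |u|² / (m - n - 1)` uniformly in `ε`.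
Since `tr R ≥ 1/ε` whenever `W` is singular, Markov's inequality shows that `W` is almost surely
invertible (`ae_det_gram_ne_zero`); Fatou's lemma then makes `uᵀ W⁻¹ u` integrable, and since it
dominates the three terms with a factor `ε` up to constants, letting `ε → 0` by dominated convergence
gives `integral_gramInv_quadratic`. -/

namespace InverseWishart

open Filter Topology

/-! ### The ridge-regularised inverse Gram matrix -/

section Ridge

variable {ι κ : Type*} [Fintype ι] [Fintype κ] [DecidableEq ι]

/-- The regularised inverse `(ε + YᵀY)⁻¹` of the Gram matrix of `Y`. The samples are the rows of
`Y`, so that `Y` is a point of the product space `κ → ι → ℝ`. -/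
noncomputable def ridgeInv (ε : ℝ) (Y : Matrix κ ι ℝ) : Matrix ι ι ℝ :=
  (ε • (1 : Matrix ι ι ℝ) + Yᵀ * Y)⁻¹

lemma posDef_ridge {ε : ℝ} (hε : 0 < ε) (Y : Matrix κ ι ℝ) :
    (ε • (1 : Matrix ι ι ℝ) + Yᵀ * Y).PosDef := by
  refine (PosDef.one.smul hε).add_posSemidef ?_
  simpa [conjTranspose_eq_transpose_of_trivial] using posSemidef_conjTranspose_mul_self Y

lemma isUnit_det_ridge {ε : ℝ} (hε : 0 < ε) (Y : Matrix κ ι ℝ) :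
    IsUnit (ε • (1 : Matrix ι ι ℝ) + Yᵀ * Y).det :=
  (posDef_ridge hε Y).det_pos.ne'.isUnit

lemma ridgeInv_transpose (ε : ℝ) (Y : Matrix κ ι ℝ) : (ridgeInv ε Y)ᵀ = ridgeInv ε Y := by
  simp [ridgeInv, transpose_nonsing_inv, transpose_mul]

lemma ridgeInv_comm (ε : ℝ) (Y : Matrix κ ι ℝ) (a b : ι) :
    ridgeInv ε Y a b = ridgeInv ε Y b a := by
  conv_lhs => rw [← ridgeInv_transpose]
  rfl

lemma gram_mul_ridgeInv {ε : ℝ} (hε : 0 < ε) (Y : Matrix κ ι ℝ) :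
    Yᵀ * Y * ridgeInv ε Y = 1 - ε • ridgeInv ε Y := by
  have h := mul_nonsing_inv _ (isUnit_det_ridge hε Y)
  rw [Matrix.add_mul, Matrix.smul_mul, Matrix.one_mul] at h
  exact eq_sub_of_add_eq' h

lemma ridgeInv_mul_gram {ε : ℝ} (hε : 0 < ε) (Y : Matrix κ ι ℝ) :
    ridgeInv ε Y * (Yᵀ * Y) = 1 - ε • ridgeInv ε Y := by
  have h := nonsing_inv_mul _ (isUnit_det_ridge hε Y)
  rw [Matrix.mul_add, Matrix.mul_smul, Matrix.mul_one] at h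
  exact eq_sub_of_add_eq' h

lemma transpose_mul_self_mul_ridgeInv {ε : ℝ} (hε : 0 < ε) (Y : Matrix κ ι ℝ) :
    (Y * ridgeInv ε Y)ᵀ * (Y * ridgeInv ε Y) =
      ridgeInv ε Y - ε • (ridgeInv ε Y * ridgeInv ε Y) := by
  rw [transpose_mul, ridgeInv_transpose, ← Matrix.mul_assoc, Matrix.mul_assoc (ridgeInv ε Y),
    ridgeInv_mul_gram hε, Matrix.sub_mul, Matrix.one_mul, Matrix.smul_mul]

lemma ridgeInv_diag_eq {ε : ℝ} (hε : 0 < ε) (Y : Matrix κ ι ℝ) (b : ι) :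
    ridgeInv ε Y b b = ∑ k, (Y * ridgeInv ε Y) k b ^ 2 + ε * ∑ c, ridgeInv ε Y b c ^ 2 := by
  have h := congrFun₂ (transpose_mul_self_mul_ridgeInv hε Y) b b
  simp only [mul_apply (M := (Y * ridgeInv ε Y)ᵀ), transpose_apply, Matrix.sub_apply,
    Matrix.smul_apply, mul_apply (M := ridgeInv ε Y) (N := ridgeInv ε Y), smul_eq_mul] at h
  have h2 : ∑ c, ridgeInv ε Y b c ^ 2 = ∑ j, ridgeInv ε Y b j * ridgeInv ε Y j b :=
    Finset.sum_congr rfl fun c _ => by rw [ridgeInv_comm ε Y c b, pow_two]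
  rw [h2]
  simp only [pow_two, h]
  ring

lemma ridgeInv_diag_nonneg {ε : ℝ} (hε : 0 < ε) (Y : Matrix κ ι ℝ) (b : ι) :
    0 ≤ ridgeInv ε Y b b := by
  rw [ridgeInv_diag_eq hε]
  positivity

lemma mul_sum_sq_ridgeInv_le {ε : ℝ} (hε : 0 < ε) (Y : Matrix κ ι ℝ) (b : ι) :
    ε * ∑ c, ridgeInv ε Y b c ^ 2 ≤ ridgeInv ε Y b b := by
  rw [ridgeInv_diag_eq hε Y b]
  exact le_add_of_nonneg_left (by positivity)

lemma mul_ridgeInv_sq_le {ε : ℝ} (hε : 0 < ε) (Y : Matrix κ ι ℝ) (b c : ι) :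
    ε * ridgeInv ε Y b c ^ 2 ≤ ridgeInv ε Y b b := by
  refine le_trans ?_ (mul_sum_sq_ridgeInv_le hε Y b)
  gcongr
  exact Finset.single_le_sum (f := fun c => ridgeInv ε Y b c ^ 2) (fun _ _ => sq_nonneg _)
    (Finset.mem_univ c)

lemma mul_ridgeInv_diag_le {ε : ℝ} (hε : 0 < ε) (Y : Matrix κ ι ℝ) (b : ι) :
    ε * ridgeInv ε Y b b ≤ 1 := by
  have h := mul_ridgeInv_sq_le hε Y b b
  rcases (ridgeInv_diag_nonneg hε Y b).eq_or_lt with h0 | h0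
  · rw [← h0]; simp
  · nlinarith

lemma abs_ridgeInv_le {ε : ℝ} (hε : 0 < ε) (Y : Matrix κ ι ℝ) (b c : ι) :
    |ridgeInv ε Y b c| ≤ ε⁻¹ := by
  have h := mul_ridgeInv_sq_le hε Y b c
  have h1 := mul_ridgeInv_diag_le hε Y b
  refine abs_le_of_sq_le_sq ?_ (by positivity)
  rw [inv_pow, ← one_div, le_div_iff₀ (by positivity)]
  nlinarith

lemma sq_mul_ridgeInv_le {ε : ℝ} (hε : 0 < ε) (Y : Matrix κ ι ℝ) (k : κ) (b : ι) :
    (Y * ridgeInv ε Y) k b ^ 2 ≤ ε⁻¹ := by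
  have h1 := mul_ridgeInv_diag_le hε Y b
  have h2 : ridgeInv ε Y b b ≤ ε⁻¹ := by
    rw [← one_div, le_div_iff₀ hε]; linarith
  refine le_trans ?_ h2
  rw [ridgeInv_diag_eq hε Y b]
  refine le_add_of_le_of_nonneg ?_ (by positivity)
  exact Finset.single_le_sum (f := fun k => (Y * ridgeInv ε Y) k b ^ 2) (fun _ _ => sq_nonneg _)
    (Finset.mem_univ k)

/-- The diagonal entries of the regularised hat matrix `Y (ε + YᵀY)⁻¹ Yᵀ` lie in `[0, 1]`,
because `H - H² = ε (Y R)(Y R)ᵀ` for a hat matrix `H` with regularised inverse `R`. -/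
lemma hat_diag_mem_Icc {ε : ℝ} (hε : 0 < ε) (Y : Matrix κ ι ℝ) (k : κ) :
    (Y * ridgeInv ε Y * Yᵀ) k k ∈ Set.Icc (0 : ℝ) 1 := by
  set H := Y * ridgeInv ε Y * Yᵀ with hH
  have hs : Hᵀ = H := by
    rw [hH, transpose_mul, transpose_mul, ridgeInv_transpose, transpose_transpose,
      Matrix.mul_assoc]
  have h : H - H * Hᵀ = ε • ((Y * ridgeInv ε Y) * (Y * ridgeInv ε Y)ᵀ) := by
    rw [hs]
    calc H - H * H = Y * ridgeInv ε Y * Yᵀ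
          - Y * (ridgeInv ε Y * (Yᵀ * Y)) * ridgeInv ε Y * Yᵀ := by
          simp only [hH, Matrix.mul_assoc]
      _ = _ := by
          rw [ridgeInv_mul_gram hε, transpose_mul, ridgeInv_transpose]
          simp [Matrix.mul_sub, Matrix.sub_mul, Matrix.mul_assoc]
  have h1 := congrFun₂ h k k
  rw [Matrix.sub_apply, Matrix.smul_apply, smul_eq_mul, mul_apply (M := H),
    mul_apply (M := Y * ridgeInv ε Y)] at h1
  simp only [transpose_apply, ← pow_two] at h1
  have h2 : 0 ≤ ε * ∑ c, (Y * ridgeInv ε Y) k c ^ 2 := by positivity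
  have h3 : H k k ^ 2 ≤ ∑ l, H k l ^ 2 :=
    Finset.single_le_sum (f := fun l => H k l ^ 2) (fun _ _ => sq_nonneg _) (Finset.mem_univ k)
  have h4 : H k k ^ 2 ≤ H k k := by linarith
  constructor <;> nlinarith

lemma continuous_ridgeInv {ε : ℝ} (hε : 0 < ε) :
    Continuous (fun Y : Matrix κ ι ℝ => ridgeInv ε Y) := by
  have hA : Continuous (fun Y : Matrix κ ι ℝ => ε • (1 : Matrix ι ι ℝ) + Yᵀ * Y) := by fun_prop
  simp only [ridgeInv, inv_def, Ring.inverse_eq_inv']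
  exact (hA.matrix_det.inv₀ fun Y => (posDef_ridge hε Y).det_pos.ne').smul hA.matrix_adjugate

end Ridge

/-! ### Gaussian integration by parts -/

section Stein

lemma hasDerivAt_gaussianPDFReal_std (x : ℝ) :
    HasDerivAt (gaussianPDFReal 0 1) (-x * gaussianPDFReal 0 1 x) x := by
  have h : HasDerivAt (fun x : ℝ => -(x - 0) ^ 2 / (2 * ((1 : NNReal) : ℝ))) (-x) x := by
    have := (((hasDerivAt_id x).sub_const 0).pow 2).neg.div_const (2 * ((1 : NNReal) : ℝ))
    refine this.congr_deriv ?_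
    simp; ring
  rw [gaussianPDFReal_def]
  refine (h.exp.const_mul ((√(2 * Real.pi * ((1 : NNReal) : ℝ)))⁻¹)).congr_deriv ?_
  ring

/-- Stein's identity for the standard normal law. -/
lemma integral_id_mul_gaussianReal {f f' : ℝ → ℝ} {C : ℝ} (hf : ∀ t, HasDerivAt f (f' t) t)
    (hf' : Measurable f') (hfC : ∀ t, |f t| ≤ C) (hf'C : ∀ t, |f' t| ≤ C) :
    ∫ t, t * f t ∂(gaussianReal 0 1) = ∫ t, f' t ∂(gaussianReal 0 1) := by
  have hfm : Measurable f :=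
    (continuous_iff_continuousAt.2 fun t => (hf t).continuousAt).measurable
  have hid : Integrable (fun t : ℝ => t * gaussianPDFReal 0 1 t) := by
    have h : Integrable (fun t : ℝ => t) (gaussianReal 0 1) := IsGaussian.integrable_id
    rw [gaussianReal_of_var_ne_zero _ one_ne_zero, integrable_withDensity_iff
      (measurable_gaussianPDF _ _) (ae_of_all _ fun _ => gaussianPDF_lt_top)] at h
    simpa [toReal_gaussianPDF] using h
  rw [integral_gaussianReal_eq_integral_smul one_ne_zero,
    integral_gaussianReal_eq_integral_smul one_ne_zero]
  have h := integral_mul_deriv_eq_deriv_mul_of_integrable (u := f) (u' := f')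
    (v := gaussianPDFReal 0 1) (v' := fun x => -x * gaussianPDFReal 0 1 x)
    (fun x _ => hf x) (fun x _ => hasDerivAt_gaussianPDFReal_std x) ?_ ?_ ?_
  · simp only [smul_eq_mul]
    rw [← neg_inj, ← integral_neg]
    calc _ = ∫ x, f x * (-x * gaussianPDFReal 0 1 x) := by congr 1; ext x; ring
      _ = _ := h
      _ = _ := by congr 2; ext x; ring
  · refine (hid.neg.bdd_mul (c := C) hfm.aestronglyMeasurable (ae_of_all _ hfC)).congr ?_
    exact ae_of_all _ fun x => by simp
  · exact (integrable_gaussianPDFReal 0 1).bdd_mul (c := C) hf'.aestronglyMeasurable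
      (ae_of_all _ hf'C)
  · exact (integrable_gaussianPDFReal 0 1).bdd_mul (c := C) hfm.aestronglyMeasurable
      (ae_of_all _ hfC)

/-- Resampling one coordinate of a product probability measure does not change it. -/
lemma measurePreserving_update {ι : Type*} [Fintype ι] [DecidableEq ι] {α : ι → Type*}
    [∀ i, MeasurableSpace (α i)] (μ : ∀ i, Measure (α i)) [∀ i, IsProbabilityMeasure (μ i)]
    (i : ι) :
    MeasurePreserving (fun p : (∀ i, α i) × α i => Function.update p.1 i p.2)
      ((Measure.pi μ).prod (μ i)) (Measure.pi μ) := by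
  have hmeas : Measurable (fun p : (∀ i, α i) × α i => Function.update p.1 i p.2) := by
    refine measurable_pi_iff.2 fun j => ?_
    by_cases h : j = i
    · subst h; simpa using measurable_snd
    · simpa only [Function.update_of_ne h] using! (measurable_pi_apply j).comp measurable_fst
  refine ⟨hmeas, (Measure.pi_eq fun s hs => ?_).symm⟩
  rw [Measure.map_apply hmeas (.univ_pi hs)]
  have : (fun p : (∀ i, α i) × α i => Function.update p.1 i p.2) ⁻¹' Set.univ.pi s =
      (Set.univ.pi (Function.update s i Set.univ)) ×ˢ s i := by
    ext p
    simp only [Set.mem_preimage, Set.mem_univ_pi, Set.mem_prod]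
    constructor
    · intro h
      refine ⟨fun j => ?_, by simpa using h i⟩
      by_cases hj : j = i
      · subst hj; simp
      · simpa [Function.update_of_ne hj] using h j
    · rintro ⟨h1, h2⟩ j
      by_cases hj : j = i
      · subst hj; simpa using h2
      · simpa [Function.update_of_ne hj] using h1 j
  rw [this, Measure.prod_prod, Measure.pi_pi, ← Finset.mul_prod_erase _ _ (Finset.mem_univ i),
    ← Finset.mul_prod_erase _ (fun i => μ i (s i)) (Finset.mem_univ i)]
  simp only [Function.update_self, measure_univ, one_mul]
  rw [mul_comm]
  congr 1
  refine Finset.prod_congr rfl fun j hj => ?_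
  rw [Function.update_of_ne (Finset.ne_of_mem_erase hj)]

variable {ι κ : Type*} [Fintype ι] [Fintype κ]

/-- The law of a `κ × ι` array of independent standard normal variables. -/
noncomputable def gaussianArray (κ ι : Type*) [Fintype ι] [Fintype κ] : Measure (κ → ι → ℝ) :=
  Measure.pi fun _ : κ => Measure.pi fun _ : ι => gaussianReal 0 1

instance : IsProbabilityMeasure (gaussianArray κ ι) := by
  unfold gaussianArray; infer_instance

/-- The array `Z` with the entry `(k, a)` replaced by `t`. -/
def setEntry [DecidableEq ι] [DecidableEq κ] (Z : κ → ι → ℝ) (k : κ) (a : ι) (t : ℝ) :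
    κ → ι → ℝ :=
  Function.update Z k (Function.update (Z k) a t)

lemma measurePreserving_setEntry [DecidableEq ι] [DecidableEq κ] (k : κ) (a : ι) :
    MeasurePreserving (fun p : (κ → ι → ℝ) × ℝ => setEntry p.1 k a p.2)
      ((gaussianArray κ ι).prod (gaussianReal 0 1)) (gaussianArray κ ι) := by
  -- resample the row `k` by an independent row whose entry `a` has itself been resampled
  let ρ : Measure (ι → ℝ) := Measure.pi fun _ : ι => gaussianReal 0 1
  have hrow : MeasurePreserving (fun p : (ι → ℝ) × ℝ => Function.update p.1 a p.2)
      (ρ.prod (gaussianReal 0 1)) ρ := measurePreserving_update (fun _ : ι => gaussianReal 0 1) a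
  have hcol : MeasurePreserving (fun p : (κ → ι → ℝ) × (ι → ℝ) => Function.update p.1 k p.2)
      ((gaussianArray κ ι).prod ρ) (gaussianArray κ ι) := measurePreserving_update (fun _ : κ => ρ) k
  have h1 : MeasurePreserving
      (fun p : (κ → ι → ℝ) × ((ι → ℝ) × ℝ) => Function.update p.1 k (Function.update p.2.1 a p.2.2))
      ((gaussianArray κ ι).prod (ρ.prod (gaussianReal 0 1))) (gaussianArray κ ι) :=
    hcol.comp ((MeasurePreserving.id _).prod hrow)
  have h2 : MeasurePreserving (fun p : ((κ → ι → ℝ) × (ι → ℝ)) × ℝ =>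
      ((Function.update p.1.1 k p.1.2 : κ → ι → ℝ), p.2))
      (((gaussianArray κ ι).prod ρ).prod (gaussianReal 0 1))
      ((gaussianArray κ ι).prod (gaussianReal 0 1)) :=
    hcol.prod (MeasurePreserving.id _)
  have h3 := h1.comp (measurePreserving_prodAssoc (gaussianArray κ ι) ρ (gaussianReal 0 1))
  have hmeas : Measurable (fun p : (κ → ι → ℝ) × ℝ => setEntry p.1 k a p.2) := by
    refine measurable_pi_iff.2 fun l => measurable_pi_iff.2 fun b => ?_
    unfold setEntry
    by_cases hl : l = k
    · subst hl
      by_cases hb : b = a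
      · subst hb; simpa using measurable_snd
      · simp only [Function.update_self, Function.update_of_ne hb]
        fun_prop
    · simp only [Function.update_of_ne hl]
      fun_prop
  refine ⟨hmeas, ?_⟩
  rw [← h2.map_eq, Measure.map_map hmeas h2.measurable]
  convert h3.map_eq using 2
  ext p : 1
  simp [setEntry, MeasurableEquiv.prodAssoc]

/-- Stein's identity in one entry of a Gaussian array. -/
lemma integral_entry_mul_gaussianArray [DecidableEq ι] [DecidableEq κ] (k : κ) (a : ι)
    {F F' : (κ → ι → ℝ) → ℝ} {C : ℝ} (hF : Measurable F) (hF' : Measurable F')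
    (hFC : ∀ Z, |F Z| ≤ C) (hF'C : ∀ Z, |F' Z| ≤ C)
    (hderiv : ∀ Z t, HasDerivAt (fun s => F (setEntry Z k a s)) (F' (setEntry Z k a t)) t) :
    Integrable (fun Z => Z k a * F Z) (gaussianArray κ ι) ∧
    ∫ Z, Z k a * F Z ∂(gaussianArray κ ι) = ∫ Z, F' Z ∂(gaussianArray κ ι) := by
  have hset := measurePreserving_setEntry (ι := ι) (κ := κ) k a
  have hent : ∀ Z : κ → ι → ℝ, ∀ t, setEntry Z k a t k a = t := by simp [setEntry]
  have hmp : MeasurePreserving (fun Z : κ → ι → ℝ => Z k a) (gaussianArray κ ι)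
      (gaussianReal 0 1) :=
    (measurePreserving_eval (fun _ : ι => gaussianReal 0 1) a).comp
      (measurePreserving_eval (fun _ : κ => Measure.pi fun _ : ι => gaussianReal 0 1) k)
  have hint : Integrable (fun Z => Z k a * F Z) (gaussianArray κ ι) := by
    have h : Integrable (fun Z : κ → ι → ℝ => Z k a) (gaussianArray κ ι) :=
      hmp.integrable_comp_of_integrable (g := id) IsGaussian.integrable_id
    exact h.mul_bdd (c := C) hF.aestronglyMeasurable (ae_of_all _ hFC)
  have hint' : Integrable F' (gaussianArray κ ι) :=
    Integrable.of_bound hF'.aestronglyMeasurable C (ae_of_all _ hF'C)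
  refine ⟨hint, ?_⟩
  have key : ∀ G : (κ → ι → ℝ) → ℝ, Integrable G (gaussianArray κ ι) →
      ∫ Z, G Z ∂(gaussianArray κ ι) =
        ∫ Z, ∫ t, G (setEntry Z k a t) ∂(gaussianReal 0 1) ∂(gaussianArray κ ι) := by
    intro G hG
    conv_lhs => rw [← hset.map_eq]
    rw [integral_map hset.measurable.aemeasurable (by rw [hset.map_eq]; exact hG.1)]
    exact integral_prod _ (hset.integrable_comp_of_integrable hG)
  rw [key _ hint, key _ hint']
  congr 1
  ext Z
  simp only [hent]
  have hcurve : Measurable fun t => setEntry Z k a t :=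
    hset.measurable.comp (measurable_const.prodMk measurable_id)
  exact integral_id_mul_gaussianReal (hderiv Z) (hF'.comp hcurve) (fun t => hFC _)
    (fun t => hF'C _)

end Stein

/-! ### Derivatives of matrix curves -/

section Haff

lemma hasDerivAt_matrix_iff {p q : Type*} [Fintype p] [Fintype q] {A : ℝ → Matrix p q ℝ}
    {A' : Matrix p q ℝ} {t : ℝ} :
    HasDerivAt A A' t ↔ ∀ i j, HasDerivAt (fun s => A s i j) (A' i j) t := by
  have h := hasDerivAt_pi (φ := fun s i => (A s i : q → ℝ)) (φ' := fun i => A' i) (x := t)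
  refine Iff.trans h (forall_congr' fun i => ?_)
  exact hasDerivAt_pi

lemma hasDerivAt_matrix_mul {p q r : Type*} [Fintype p] [Fintype q] [Fintype r]
    {A : ℝ → Matrix p q ℝ} {B : ℝ → Matrix q r ℝ} {A' : Matrix p q ℝ} {B' : Matrix q r ℝ} {t : ℝ}
    (hA : HasDerivAt A A' t) (hB : HasDerivAt B B' t) :
    HasDerivAt (fun s => A s * B s) (A' * B t + A t * B') t := by
  rw [hasDerivAt_matrix_iff] at *
  intro i j
  simp only [mul_apply, Matrix.add_apply, ← Finset.sum_add_distrib]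
  exact HasDerivAt.fun_sum fun l _ => (hA i l).mul (hB l j)

section

-- any submultiplicative norm will do: it only serves to differentiate the inverse in a normed algebra
attribute [local instance] Matrix.linftyOpNormedRing Matrix.linftyOpNormedAlgebra

lemma hasDerivAt_matrix_inv {p : Type*} [Fintype p] [DecidableEq p]
    {A : ℝ → Matrix p p ℝ} {A' : Matrix p p ℝ} {t : ℝ} (hA : HasDerivAt A A' t)
    (h : IsUnit (A t).det) :
    HasDerivAt (fun s => (A s)⁻¹) (-((A t)⁻¹ * A' * (A t)⁻¹)) t := by
  obtain ⟨u, hu⟩ := (isUnit_iff_isUnit_det (A t)).2 h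
  have h1 := hasFDerivAt_ringInverse (𝕜 := ℝ) u
  rw [hu] at h1
  have h2 := h1.comp_hasDerivAt t hA
  simp only [Function.comp_def, ← nonsing_inv_eq_ringInverse] at h2
  refine h2.congr_deriv ?_
  simp [← hu, coe_units_inv]

end

variable {ι κ : Type*} [Fintype ι] [Fintype κ] [DecidableEq ι] [DecidableEq κ]

lemma hasDerivAt_setEntry (Z : κ → ι → ℝ) (k : κ) (a : ι) (t : ℝ) :
    HasDerivAt (fun s => Matrix.of (setEntry Z k a s)) (Matrix.single k a (1 : ℝ)) t := by
  rw [hasDerivAt_matrix_iff]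
  intro l b
  simp only [of_apply, setEntry]
  by_cases hl : l = k
  · subst hl
    by_cases hb : b = a
    · subst hb
      simpa using hasDerivAt_id' t
    · simpa [Function.update_of_ne hb, single_apply_of_ne _ _ _ _ _ (fun h => hb h.2.symm)] using
        hasDerivAt_const t (Z l b)
  · simpa [Function.update_of_ne hl, single_apply_of_ne _ _ _ _ _ (fun h => hl h.1.symm)] using
      hasDerivAt_const t (Z l b)

lemma mul_single_mul_apply {p q r s : Type*} [Fintype q] [Fintype r] [DecidableEq q]
    [DecidableEq r] (A : Matrix p q ℝ) (B : Matrix r s ℝ) (i : p) (j : q) (l : r) (o : s) :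
    (A * Matrix.single j l (1 : ℝ) * B) i o = A i j * B l o := by
  rw [mul_apply, Finset.sum_eq_single l]
  · simp
  · intro x _ hx
    simp [Matrix.mul_single_apply_of_ne _ _ _ _ _ hx]
  · simp

/-- The partial derivative in the entry `(k, a)` of the entry `(k, b)` of `Y R`, where
`R = (ε + YᵀY)⁻¹`. -/
lemma hasDerivAt_mul_ridgeInv {ε : ℝ} (hε : 0 < ε) (Z : κ → ι → ℝ) (k : κ) (a b : ι) (t : ℝ) :
    HasDerivAt (fun s => (Matrix.of (setEntry Z k a s) *
        ridgeInv ε (Matrix.of (setEntry Z k a s))) k b)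
      ((fun Y : Matrix κ ι ℝ => ridgeInv ε Y a b - (Y * ridgeInv ε Y * Yᵀ) k k * ridgeInv ε Y a b
        - (Y * ridgeInv ε Y) k a * (Y * ridgeInv ε Y) k b) (Matrix.of (setEntry Z k a t))) t := by
  set Y : ℝ → Matrix κ ι ℝ := fun s => Matrix.of (setEntry Z k a s) with hYdef
  have hY : HasDerivAt Y (Matrix.single k a (1 : ℝ)) t := hasDerivAt_setEntry Z k a t
  have hYT : HasDerivAt (fun s => (Y s)ᵀ) (Matrix.single a k (1 : ℝ)) t := by
    rw [hasDerivAt_matrix_iff] at hY ⊢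
    intro i j
    have := hY j i
    rwa [← transpose_single, transpose_apply]
  have hA : HasDerivAt (fun s => ε • (1 : Matrix ι ι ℝ) + (Y s)ᵀ * Y s)
      (Matrix.single a k (1 : ℝ) * Y t + (Y t)ᵀ * Matrix.single k a (1 : ℝ)) t := by
    have hW := hasDerivAt_matrix_mul hYT hY
    rw [hasDerivAt_matrix_iff] at hW ⊢
    exact fun i j => (hW i j).const_add _
  have hR := hasDerivAt_matrix_inv hA (isUnit_det_ridge hε (Y t))
  have hG := hasDerivAt_matrix_iff.1 (hasDerivAt_matrix_mul hY hR) k b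
  refine hG.congr_deriv ?_
  change (Matrix.single k a (1 : ℝ) * ridgeInv ε (Y t) + Y t * -(ridgeInv ε (Y t) *
    (Matrix.single a k (1 : ℝ) * Y t + (Y t)ᵀ * Matrix.single k a (1 : ℝ)) * ridgeInv ε (Y t))) k b
    = _
  have e : Matrix.single k a (1 : ℝ) * ridgeInv ε (Y t) + Y t * -(ridgeInv ε (Y t) *
      (Matrix.single a k (1 : ℝ) * Y t + (Y t)ᵀ * Matrix.single k a (1 : ℝ)) * ridgeInv ε (Y t))
      = Matrix.single k a (1 : ℝ) * ridgeInv ε (Y t)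
        - (Y t * ridgeInv ε (Y t)) * Matrix.single a k (1 : ℝ) * (Y t * ridgeInv ε (Y t))
        - (Y t * ridgeInv ε (Y t) * (Y t)ᵀ) * Matrix.single k a (1 : ℝ) * ridgeInv ε (Y t) := by
    simp only [Matrix.mul_neg, Matrix.mul_add, Matrix.add_mul, Matrix.mul_assoc]
    abel
  have e0 : (Matrix.single k a (1 : ℝ) * ridgeInv ε (Y t)) k b = ridgeInv ε (Y t) a b := by
    simp
  rw [e, Matrix.sub_apply, Matrix.sub_apply, e0, mul_single_mul_apply, mul_single_mul_apply]
  ring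

/-! ### The Stein–Haff identity -/

lemma continuous_comp_of {p q E : Type*} [TopologicalSpace E] {f : Matrix p q ℝ → E}
    (hf : Continuous f) : Continuous fun Z : p → q → ℝ => f (Matrix.of Z) := hf

/-- The regularised Stein–Haff identity for `m` samples in dimension `n`: with `R = (ε + YᵀY)⁻¹`, the
expectation of `(m - n - 1) R + ε tr(R) R + ε R² + ε R` is the identity matrix. It is Stein's identity
for the entries of `Y R`, summed over the samples. -/
lemma integral_ridgeInv {ε : ℝ} (hε : 0 < ε) (a b : ι) :
    Integrable (fun Z => ((Fintype.card κ : ℝ) - Fintype.card ι - 1) * ridgeInv ε (Matrix.of Z) a b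
      + ε * (ridgeInv ε (Matrix.of Z)).trace * ridgeInv ε (Matrix.of Z) a b
      + ε * (ridgeInv ε (Matrix.of Z) * ridgeInv ε (Matrix.of Z)) a b
      + ε * ridgeInv ε (Matrix.of Z) a b) (gaussianArray κ ι) ∧
    ∫ Z, (((Fintype.card κ : ℝ) - Fintype.card ι - 1) * ridgeInv ε (Matrix.of Z) a b
      + ε * (ridgeInv ε (Matrix.of Z)).trace * ridgeInv ε (Matrix.of Z) a b
      + ε * (ridgeInv ε (Matrix.of Z) * ridgeInv ε (Matrix.of Z)) a b
      + ε * ridgeInv ε (Matrix.of Z) a b) ∂(gaussianArray κ ι) = (1 : Matrix ι ι ℝ) a b := by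
  have hRc : Continuous fun Y : Matrix κ ι ℝ => ridgeInv ε Y := continuous_ridgeInv hε
  have hRe : ∀ a b : ι, Continuous fun Y : Matrix κ ι ℝ => ridgeInv ε Y a b :=
    fun a b => hRc.matrix_elem a b
  have hGc : Continuous fun Y : Matrix κ ι ℝ => Y * ridgeInv ε Y := continuous_id.matrix_mul hRc
  have hGe : ∀ (k : κ) (b : ι), Continuous fun Y : Matrix κ ι ℝ => (Y * ridgeInv ε Y) k b :=
    fun k b => hGc.matrix_elem k b
  have hHe : ∀ k : κ, Continuous fun Y : Matrix κ ι ℝ => (Y * ridgeInv ε Y * Yᵀ) k k :=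
    fun k => (hGc.matrix_mul continuous_id.matrix_transpose).matrix_elem k k
  let D : κ → Matrix κ ι ℝ → ℝ := fun k Y =>
    ridgeInv ε Y a b - (Y * ridgeInv ε Y * Yᵀ) k k * ridgeInv ε Y a b
      - (Y * ridgeInv ε Y) k a * (Y * ridgeInv ε Y) k b
  have hDc : ∀ k, Continuous (D k) := fun k =>
    ((hRe a b).sub ((hHe k).mul (hRe a b))).sub ((hGe k a).mul (hGe k b))
  have hε' : 0 < ε⁻¹ := by positivity
  have hDb : ∀ k Y, |D k Y| ≤ 2 * ε⁻¹ := by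
    intro k Y
    have h1 := abs_ridgeInv_le hε Y a b
    have h2 := hat_diag_mem_Icc hε Y k
    have h3 := sq_mul_ridgeInv_le hε Y k a
    have h4 := sq_mul_ridgeInv_le hε Y k b
    have e1 : |ridgeInv ε Y a b - (Y * ridgeInv ε Y * Yᵀ) k k * ridgeInv ε Y a b| ≤ ε⁻¹ := by
      have : ridgeInv ε Y a b - (Y * ridgeInv ε Y * Yᵀ) k k * ridgeInv ε Y a b =
        (1 - (Y * ridgeInv ε Y * Yᵀ) k k) * ridgeInv ε Y a b := by ring
      rw [this, abs_mul, abs_of_nonneg (by linarith [h2.2])]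
      calc _ ≤ 1 * |ridgeInv ε Y a b| := by gcongr; linarith [h2.1]
        _ ≤ _ := by linarith
    have e2 : |(Y * ridgeInv ε Y) k a * (Y * ridgeInv ε Y) k b| ≤ ε⁻¹ := by
      rw [abs_le]
      constructor <;>
        nlinarith [sq_nonneg ((Y * ridgeInv ε Y) k a - (Y * ridgeInv ε Y) k b),
          sq_nonneg ((Y * ridgeInv ε Y) k a + (Y * ridgeInv ε Y) k b)]
    calc |D k Y| ≤ _ := abs_sub _ _
      _ ≤ 2 * ε⁻¹ := by linarith
  have hGb : ∀ k (Y : Matrix κ ι ℝ), |(Y * ridgeInv ε Y) k b| ≤ ε⁻¹ + 1 := by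
    intro k Y
    refine abs_le_of_sq_le_sq ?_ (by positivity)
    nlinarith [sq_mul_ridgeInv_le hε Y k b]
  have hbd : ∀ {f : Matrix κ ι ℝ → ℝ}, Continuous f → (∃ C, ∀ Y, |f Y| ≤ C) →
      Integrable (fun Z => f (Matrix.of Z)) (gaussianArray κ ι) := by
    rintro f hf ⟨C, hC⟩
    exact Integrable.of_bound (continuous_comp_of hf).measurable.aestronglyMeasurable C
      (ae_of_all _ fun Z => hC _)
  have hst : ∀ k, Integrable (fun Z => Z k a * (Matrix.of Z * ridgeInv ε (Matrix.of Z)) k b)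
      (gaussianArray κ ι) ∧
      ∫ Z, Z k a * (Matrix.of Z * ridgeInv ε (Matrix.of Z)) k b ∂(gaussianArray κ ι) =
      ∫ Z, D k (Matrix.of Z) ∂(gaussianArray κ ι) := fun k =>
    integral_entry_mul_gaussianArray k a (C := 2 * ε⁻¹ + 1)
      (F := fun Z => (Matrix.of Z * ridgeInv ε (Matrix.of Z)) k b)
      (F' := fun Z => D k (Matrix.of Z))
      (continuous_comp_of (hGe k b)).measurable (continuous_comp_of (hDc k)).measurable
      (fun Z => (hGb k _).trans (by linarith)) (fun Z => (hDb k _).trans (by linarith))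
      (fun Z t => hasDerivAt_mul_ridgeInv hε Z k a b t)
  have hDi : ∀ k, Integrable (fun Z => D k (Matrix.of Z)) (gaussianArray κ ι) :=
    fun k => hbd (hDc k) ⟨_, hDb k⟩
  have hRi : Integrable (fun Z => ridgeInv ε (Matrix.of Z) a b) (gaussianArray κ ι) :=
    hbd (hRe a b) ⟨_, fun Y => abs_ridgeInv_le hε Y a b⟩
  -- summing Stein's identity over the samples
  have hsum : ∫ Z, ∑ k, Z k a * (Matrix.of Z * ridgeInv ε (Matrix.of Z)) k b ∂(gaussianArray κ ι)
      = ∫ Z, ∑ k, D k (Matrix.of Z) ∂(gaussianArray κ ι) := by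
    rw [integral_finsetSum _ fun k _ => (hst k).1, integral_finsetSum _ fun k _ => hDi k]
    exact Finset.sum_congr rfl fun k _ => (hst k).2
  have hL : ∀ Y : Matrix κ ι ℝ, ∑ k, Y k a * (Y * ridgeInv ε Y) k b
      = (1 : Matrix ι ι ℝ) a b - ε * ridgeInv ε Y a b := by
    intro Y
    have := congrFun₂ (gram_mul_ridgeInv hε Y) a b
    rw [Matrix.mul_assoc, mul_apply] at this
    simpa using this
  have hR : ∀ Y : Matrix κ ι ℝ, ∑ k, D k Y =
      ((Fintype.card κ : ℝ) - Fintype.card ι - 1) * ridgeInv ε Y a b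
      + ε * (ridgeInv ε Y).trace * ridgeInv ε Y a b
      + ε * (ridgeInv ε Y * ridgeInv ε Y) a b := by
    intro Y
    have htr : ∑ k, (Y * ridgeInv ε Y * Yᵀ) k k
        = (Fintype.card ι : ℝ) - ε * (ridgeInv ε Y).trace := by
      change (Y * ridgeInv ε Y * Yᵀ).trace = _
      rw [trace_mul_comm, ← Matrix.mul_assoc, gram_mul_ridgeInv hε, trace_sub, trace_one,
        trace_smul, smul_eq_mul]
    have hGG : ∑ k, (Y * ridgeInv ε Y) k a * (Y * ridgeInv ε Y) k b
        = ridgeInv ε Y a b - ε * (ridgeInv ε Y * ridgeInv ε Y) a b := by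
      have := congrFun₂ (transpose_mul_self_mul_ridgeInv hε Y) a b
      rw [mul_apply] at this
      simpa using this
    simp only [D, Finset.sum_sub_distrib, ← Finset.sum_mul, htr, hGG]
    simp
    ring
  have hL' : ∀ Z : κ → ι → ℝ, ∑ k, Z k a * (Matrix.of Z * ridgeInv ε (Matrix.of Z)) k b
      = (1 : Matrix ι ι ℝ) a b - ε * ridgeInv ε (Matrix.of Z) a b := fun Z => hL (Matrix.of Z)
  simp only [hL'] at hsum
  rw [integral_sub (integrable_const _) (hRi.const_mul _), integral_const] at hsum
  have hi : Integrable (fun Z => ((Fintype.card κ : ℝ) - Fintype.card ι - 1) *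
      ridgeInv ε (Matrix.of Z) a b
      + ε * (ridgeInv ε (Matrix.of Z)).trace * ridgeInv ε (Matrix.of Z) a b
      + ε * (ridgeInv ε (Matrix.of Z) * ridgeInv ε (Matrix.of Z)) a b) (gaussianArray κ ι) := by
    simp only [← hR]
    exact integrable_finsetSum _ fun k _ => hDi k
  refine ⟨hi.add (hRi.const_mul _), ?_⟩
  rw [integral_add hi (hRi.const_mul _)]
  simp only [← hR]
  rw [← hsum]
  simp

end Haff

/-! ### Quadratic forms of the regularised inverse -/

section Limit

variable {ι κ : Type*} [Fintype ι] [Fintype κ] [DecidableEq ι]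

lemma dotProduct_self_nonneg {p : Type*} [Fintype p] (v : p → ℝ) : 0 ≤ v ⬝ᵥ v :=
  Finset.sum_nonneg fun _ _ => mul_self_nonneg _

lemma ridgeInv_quadratic_eq {ε : ℝ} (hε : 0 < ε) (Y : Matrix κ ι ℝ) (u : ι → ℝ) :
    u ⬝ᵥ ridgeInv ε Y *ᵥ u = ε * (ridgeInv ε Y *ᵥ u ⬝ᵥ ridgeInv ε Y *ᵥ u)
      + (Y *ᵥ ridgeInv ε Y *ᵥ u) ⬝ᵥ (Y *ᵥ ridgeInv ε Y *ᵥ u) := by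
  set v := ridgeInv ε Y *ᵥ u with hv
  have hu : u = ε • v + Yᵀ *ᵥ Y *ᵥ v := by
    rw [hv, mulVec_mulVec, mulVec_mulVec, gram_mul_ridgeInv hε, sub_mulVec,
      one_mulVec, smul_mulVec]
    abel
  conv_lhs => rw [hu]
  rw [add_dotProduct, smul_dotProduct, smul_eq_mul, mulVec_transpose, ← dotProduct_mulVec]

lemma ridgeInv_quadratic_nonneg {ε : ℝ} (hε : 0 < ε) (Y : Matrix κ ι ℝ) (u : ι → ℝ) :
    0 ≤ u ⬝ᵥ ridgeInv ε Y *ᵥ u := by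
  rw [ridgeInv_quadratic_eq hε]
  have h1 := dotProduct_self_nonneg (ridgeInv ε Y *ᵥ u)
  have h2 := dotProduct_self_nonneg (Y *ᵥ ridgeInv ε Y *ᵥ u)
  positivity

lemma mul_normSq_ridgeInv_mulVec_le {ε : ℝ} (hε : 0 < ε) (Y : Matrix κ ι ℝ) (u : ι → ℝ) :
    ε * (ridgeInv ε Y *ᵥ u ⬝ᵥ ridgeInv ε Y *ᵥ u) ≤ u ⬝ᵥ ridgeInv ε Y *ᵥ u := by
  rw [ridgeInv_quadratic_eq hε]
  exact le_add_of_nonneg_right (dotProduct_self_nonneg _)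

lemma trace_ridgeInv_nonneg {ε : ℝ} (hε : 0 < ε) (Y : Matrix κ ι ℝ) :
    0 ≤ (ridgeInv ε Y).trace :=
  Finset.sum_nonneg fun b _ => ridgeInv_diag_nonneg hε Y b

lemma mul_trace_ridgeInv_le {ε : ℝ} (hε : 0 < ε) (Y : Matrix κ ι ℝ) :
    ε * (ridgeInv ε Y).trace ≤ Fintype.card ι := by
  rw [trace, Finset.mul_sum]
  refine (Finset.sum_le_card_nsmul _ _ 1 fun b _ => mul_ridgeInv_diag_le hε Y b).trans ?_
  simp

/-- Regularisation decreases the quadratic form of the inverse Gram matrix. -/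
lemma ridgeInv_quadratic_le {ε : ℝ} (hε : 0 < ε) (Y : Matrix κ ι ℝ) (hY : (Yᵀ * Y).det ≠ 0)
    (u : ι → ℝ) : u ⬝ᵥ ridgeInv ε Y *ᵥ u ≤ u ⬝ᵥ (Yᵀ * Y)⁻¹ *ᵥ u := by
  have hq := ridgeInv_quadratic_eq hε Y u
  set v := ridgeInv ε Y *ᵥ u
  set w := (Yᵀ * Y)⁻¹ *ᵥ u with hw
  have hu : u = Yᵀ *ᵥ Y *ᵥ w := by
    rw [hw, mulVec_mulVec, mulVec_mulVec, mul_nonsing_inv _ hY.isUnit, one_mulVec]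
  have h1 : u ⬝ᵥ w = (Y *ᵥ w) ⬝ᵥ (Y *ᵥ w) := by
    conv_lhs => rw [hu]
    rw [mulVec_transpose, ← dotProduct_mulVec]
  have h2 : u ⬝ᵥ v = (Y *ᵥ w) ⬝ᵥ (Y *ᵥ v) := by
    conv_lhs => rw [hu]
    rw [mulVec_transpose, ← dotProduct_mulVec]
  have h3 := dotProduct_self_nonneg (Y *ᵥ w - Y *ᵥ v)
  -- `|Y w|² ≥ 2 (Y w) ⬝ (Y v) - |Y v|²`, where the right-hand side is `u ⬝ v + ε |v|²`
  simp only [sub_dotProduct, dotProduct_sub] at h3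
  rw [dotProduct_comm (Y *ᵥ v) (Y *ᵥ w)] at h3
  have h4 : 0 ≤ ε * (v ⬝ᵥ v) := mul_nonneg hε.le (dotProduct_self_nonneg v)
  linarith

/-- At a singular Gram matrix the trace of the regularised inverse blows up like `1 / ε`: a vector
of the kernel is an eigenvector for the eigenvalue `1 / ε`. -/
lemma one_le_mul_trace_ridgeInv {ε : ℝ} (hε : 0 < ε) (Y : Matrix κ ι ℝ)
    (hY : (Yᵀ * Y).det = 0) : 1 ≤ ε * (ridgeInv ε Y).trace := by
  obtain ⟨w, hw0, hw⟩ := exists_mulVec_eq_zero_iff.2 hY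
  have hRw : ε • (ridgeInv ε Y *ᵥ w) = w := by
    have := congrArg (· *ᵥ w) (ridgeInv_mul_gram hε Y)
    rw [← mulVec_mulVec, hw, mulVec_zero, sub_mulVec, one_mulVec, smul_mulVec] at this
    exact (sub_eq_zero.1 this.symm).symm
  have hpos : 0 < ∑ a, w a ^ 2 := by
    obtain ⟨a, ha⟩ := Function.ne_iff.1 hw0
    exact Finset.sum_pos' (fun _ _ => sq_nonneg _) ⟨a, Finset.mem_univ a, sq_pos_of_ne_zero ha⟩
  have hCS : ∀ a, w a ^ 2 ≤ ε ^ 2 * ((∑ b, ridgeInv ε Y a b ^ 2) * ∑ b, w b ^ 2) := by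
    intro a
    have := congrFun hRw a
    simp only [Pi.smul_apply, smul_eq_mul, mulVec, dotProduct] at this
    rw [← this, mul_pow]
    gcongr
    exact Finset.sum_mul_sq_le_sq_mul_sq _ _ _
  have h1 : ∑ a, w a ^ 2 ≤ (ε * (ridgeInv ε Y).trace) * ∑ b, w b ^ 2 := by
    calc ∑ a, w a ^ 2 ≤ ∑ a, ε ^ 2 * ((∑ b, ridgeInv ε Y a b ^ 2) * ∑ b, w b ^ 2) :=
          Finset.sum_le_sum fun a _ => hCS a
      _ = ε * (∑ a, ε * ∑ b, ridgeInv ε Y a b ^ 2) * ∑ b, w b ^ 2 := by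
          simp only [← Finset.mul_sum, ← Finset.sum_mul]; ring
      _ ≤ _ := by
          gcongr
          exact Finset.sum_le_sum fun a _ => mul_sum_sq_ridgeInv_le hε Y a
  exact le_of_mul_le_mul_right (by simpa using h1) hpos

lemma tendsto_ridgeInv_zero (Y : Matrix κ ι ℝ) (hY : (Yᵀ * Y).det ≠ 0) :
    Tendsto (fun ε => ridgeInv ε Y) (𝓝 0) (𝓝 (Yᵀ * Y)⁻¹) := by
  have h0 : ridgeInv 0 Y = (Yᵀ * Y)⁻¹ := by simp [ridgeInv]
  rw [← h0]
  change ContinuousAt (fun ε : ℝ => ridgeInv ε Y) 0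
  have hA : Continuous (fun ε : ℝ => ε • (1 : Matrix ι ι ℝ) + Yᵀ * Y) := by fun_prop
  simp only [ridgeInv, inv_def, Ring.inverse_eq_inv']
  refine (hA.matrix_det.continuousAt.inv₀ ?_).smul hA.matrix_adjugate.continuousAt
  simpa using hY

/-- The integrand `(m - n - 1) R + ε tr(R) R + ε R² + ε R` of the regularised Stein–Haff identity,
as a quadratic form evaluated at `u`. -/
noncomputable def haffForm (ε : ℝ) (u : ι → ℝ) (Y : Matrix κ ι ℝ) : ℝ :=
  ((Fintype.card κ : ℝ) - Fintype.card ι - 1) * (u ⬝ᵥ ridgeInv ε Y *ᵥ u)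
    + ε * (ridgeInv ε Y).trace * (u ⬝ᵥ ridgeInv ε Y *ᵥ u)
    + ε * (ridgeInv ε Y *ᵥ u ⬝ᵥ ridgeInv ε Y *ᵥ u)
    + ε * (u ⬝ᵥ ridgeInv ε Y *ᵥ u)

lemma integral_haffForm [DecidableEq κ] {ε : ℝ} (hε : 0 < ε) (u : ι → ℝ) :
    Integrable (fun Z => haffForm ε u (Matrix.of Z)) (gaussianArray κ ι) ∧
    ∫ Z, haffForm ε u (Matrix.of Z) ∂(gaussianArray κ ι) = u ⬝ᵥ u := by
  have h := fun a b => integral_ridgeInv (κ := κ) hε a b (ι := ι)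
  have hquad : ∀ A : Matrix ι ι ℝ, u ⬝ᵥ A *ᵥ u = ∑ a, ∑ b, u a * u b * A a b := by
    intro A
    simp only [dotProduct, mulVec, Finset.mul_sum]
    exact Finset.sum_congr rfl fun a _ => Finset.sum_congr rfl fun b _ => by ring
  have he : ∀ Y : Matrix κ ι ℝ, haffForm ε u Y = ∑ a, ∑ b, u a * u b *
      (((Fintype.card κ : ℝ) - Fintype.card ι - 1) * ridgeInv ε Y a b
      + ε * (ridgeInv ε Y).trace * ridgeInv ε Y a b
      + ε * (ridgeInv ε Y * ridgeInv ε Y) a b + ε * ridgeInv ε Y a b) := by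
    intro Y
    have h2 : ridgeInv ε Y *ᵥ u ⬝ᵥ ridgeInv ε Y *ᵥ u
        = u ⬝ᵥ (ridgeInv ε Y * ridgeInv ε Y) *ᵥ u := by
      rw [← mulVec_mulVec, dotProduct_mulVec u, ← mulVec_transpose, ridgeInv_transpose]
    rw [haffForm, h2, hquad, hquad]
    simp only [Finset.mul_sum, ← Finset.sum_add_distrib]
    exact Finset.sum_congr rfl fun a _ => Finset.sum_congr rfl fun b _ => by ring
  simp only [he]
  refine ⟨integrable_finsetSum _ fun a _ => integrable_finsetSum _ fun b _ =>
    (h a b).1.const_mul _, ?_⟩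
  rw [integral_finsetSum _ fun a _ => integrable_finsetSum _ fun b _ => (h a b).1.const_mul _]
  simp_rw [integral_finsetSum _ fun b _ => (h _ b).1.const_mul _, integral_const_mul, (h _ _).2]
  rw [← hquad, one_mulVec]

/-! ### Removing the regularisation -/

lemma measurable_gramInv (a b : ι) :
    Measurable fun Z : κ → ι → ℝ => ((Matrix.of Z)ᵀ * Matrix.of Z)⁻¹ a b := by
  have hA : Continuous fun Z : κ → ι → ℝ => (Matrix.of Z)ᵀ * Matrix.of Z :=
    continuous_comp_of (f := fun Y => Yᵀ * Y) (by fun_prop)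
  simp only [inv_def, Ring.inverse_eq_inv', Matrix.smul_apply, smul_eq_mul]
  exact hA.matrix_det.measurable.inv.mul (hA.matrix_adjugate.matrix_elem a b).measurable

lemma measurable_gramInv_quadratic (u : ι → ℝ) :
    Measurable fun Z : κ → ι → ℝ => u ⬝ᵥ ((Matrix.of Z)ᵀ * Matrix.of Z)⁻¹ *ᵥ u := by
  simp only [dotProduct, mulVec]
  exact Finset.measurable_fun_sum _ fun a _ => (Finset.measurable_fun_sum _ fun b _ =>
    (measurable_gramInv a b).mul_const _).const_mul _

lemma measurable_ridgeInv_quadratic {ε : ℝ} (hε : 0 < ε) (u : ι → ℝ) :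
    Measurable fun Z : κ → ι → ℝ => u ⬝ᵥ ridgeInv ε (Matrix.of Z) *ᵥ u := by
  refine (continuous_comp_of (f := fun Y => u ⬝ᵥ ridgeInv ε Y *ᵥ u) ?_).measurable
  exact continuous_const.dotProduct ((continuous_ridgeInv hε).matrix_mulVec continuous_const)

lemma haffForm_lower {ε : ℝ} (hε : 0 < ε) (Y : Matrix κ ι ℝ) (u : ι → ℝ) :
    ((Fintype.card κ : ℝ) - Fintype.card ι - 1) * (u ⬝ᵥ ridgeInv ε Y *ᵥ u) ≤ haffForm ε u Y := by
  have h1 := ridgeInv_quadratic_nonneg hε Y u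
  have h2 := trace_ridgeInv_nonneg hε Y
  have h3 := dotProduct_self_nonneg (ridgeInv ε Y *ᵥ u)
  have : 0 ≤ ε * (ridgeInv ε Y).trace * (u ⬝ᵥ ridgeInv ε Y *ᵥ u)
    + ε * (ridgeInv ε Y *ᵥ u ⬝ᵥ ridgeInv ε Y *ᵥ u)
    + ε * (u ⬝ᵥ ridgeInv ε Y *ᵥ u) := by positivity
  unfold haffForm
  linarith

lemma card_sub_card_sub_one_pos {p q : Type*} [Fintype p] [Fintype q]
    (hc : Fintype.card p + 1 < Fintype.card q) :
    (0 : ℝ) < (Fintype.card q : ℝ) - Fintype.card p - 1 := by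
  have : ((Fintype.card p + 1 : ℕ) : ℝ) < Fintype.card q := by exact_mod_cast hc
  push_cast at this
  linarith

variable [DecidableEq κ]

lemma integrable_ridgeInv_quadratic (hc : Fintype.card ι + 1 < Fintype.card κ) {ε : ℝ}
    (hε : 0 < ε) (u : ι → ℝ) :
    Integrable (fun Z => u ⬝ᵥ ridgeInv ε (Matrix.of Z) *ᵥ u) (gaussianArray κ ι) ∧
    ((Fintype.card κ : ℝ) - Fintype.card ι - 1) *
      ∫ Z, u ⬝ᵥ ridgeInv ε (Matrix.of Z) *ᵥ u ∂(gaussianArray κ ι) ≤ u ⬝ᵥ u := by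
  have hc' := card_sub_card_sub_one_pos hc
  have hF := integral_haffForm (κ := κ) hε u
  have hi : Integrable (fun Z => ((Fintype.card κ : ℝ) - Fintype.card ι - 1) *
      (u ⬝ᵥ ridgeInv ε (Matrix.of Z) *ᵥ u)) (gaussianArray κ ι) := by
    refine hF.1.mono' ((measurable_ridgeInv_quadratic hε u).const_mul _).aestronglyMeasurable
      (ae_of_all _ fun Z => ?_)
    rw [Real.norm_of_nonneg (mul_nonneg hc'.le (ridgeInv_quadratic_nonneg hε _ u))]
    exact haffForm_lower hε _ u
  refine ⟨?_, ?_⟩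
  · refine (hi.const_mul ((Fintype.card κ : ℝ) - Fintype.card ι - 1)⁻¹).congr
      (ae_of_all _ fun Z => ?_)
    simp only
    rw [inv_mul_cancel_left₀ hc'.ne']
  · rw [← integral_const_mul, ← hF.2]
    exact integral_mono hi hF.1 fun Z => haffForm_lower hε _ u

/-- The Gram matrix of a Gaussian array with `m > n + 1` samples is almost surely invertible, by
Markov's inequality for `ε tr (ε + W)⁻¹`. -/
lemma ae_det_gram_ne_zero (hc : Fintype.card ι + 1 < Fintype.card κ) :
    ∀ᵐ Z ∂(gaussianArray κ ι), ((Matrix.of Z)ᵀ * Matrix.of Z).det ≠ 0 := by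
  have hc' := card_sub_card_sub_one_pos hc
  set c := (Fintype.card κ : ℝ) - Fintype.card ι - 1
  have hbound : ∀ ε : ℝ, 0 < ε →
      (gaussianArray κ ι).real {Z | ((Matrix.of Z)ᵀ * Matrix.of Z).det = 0}
        ≤ ε * (Fintype.card ι / c) := by
    intro ε hε
    have hdiag : ∀ (j : ι) (Y : Matrix κ ι ℝ),
        Pi.single j 1 ⬝ᵥ ridgeInv ε Y *ᵥ Pi.single j 1 = ridgeInv ε Y j j := by simp
    have hj : ∀ j : ι, Integrable (fun Z => ridgeInv ε (Matrix.of Z) j j) (gaussianArray κ ι) ∧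
        ∫ Z, ridgeInv ε (Matrix.of Z) j j ∂(gaussianArray κ ι) ≤ 1 / c := by
      intro j
      have := integrable_ridgeInv_quadratic hc hε (Pi.single j (1 : ℝ))
      simp only [hdiag] at this
      refine ⟨this.1, ?_⟩
      rw [le_div_iff₀ hc', mul_comm]
      simpa using this.2
    have htr : Integrable (fun Z => (ridgeInv ε (Matrix.of Z)).trace) (gaussianArray κ ι) :=
      integrable_finsetSum _ fun j _ => (hj j).1
    have hE : ∫ Z, (ridgeInv ε (Matrix.of Z)).trace ∂(gaussianArray κ ι)
        ≤ Fintype.card ι / c := by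
      simp only [trace, diag_apply]
      rw [integral_finsetSum _ fun j _ => (hj j).1]
      refine (Finset.sum_le_card_nsmul _ _ _ fun j _ => (hj j).2).trans_eq ?_
      simp [div_eq_mul_inv]
    have hM := mul_meas_ge_le_integral_of_nonneg
      (ae_of_all _ fun Z => mul_nonneg hε.le (trace_ridgeInv_nonneg hε (Matrix.of Z)))
      (htr.const_mul ε) 1
    rw [one_mul, integral_const_mul] at hM
    calc _ ≤ (gaussianArray κ ι).real {Z | 1 ≤ ε * (ridgeInv ε (Matrix.of Z)).trace} :=
          measureReal_mono fun Z hZ => one_le_mul_trace_ridgeInv hε _ hZ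
      _ ≤ _ := hM
      _ ≤ _ := by gcongr
  have hzero : (gaussianArray κ ι).real {Z | ((Matrix.of Z)ᵀ * Matrix.of Z).det = 0} ≤ 0 := by
    have hlim : Tendsto (fun ε : ℝ => ε * (Fintype.card ι / c)) (𝓝[>] 0) (𝓝 0) := by
      have : Tendsto (fun ε : ℝ => ε * (Fintype.card ι / c)) (𝓝 0)
        (𝓝 (0 * (Fintype.card ι / c))) := tendsto_id.mul_const _
      rw [zero_mul] at this
      exact this.mono_left nhdsWithin_le_nhds
    exact ge_of_tendsto hlim (eventually_nhdsWithin_of_forall hbound)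
  have h0 := le_antisymm hzero measureReal_nonneg
  rw [measureReal_eq_zero_iff] at h0
  rw [ae_iff]
  simpa using h0

/-- The mean of the inverse Wishart law with identity scale, as a quadratic form. -/
lemma integral_gramInv_quadratic (hc : Fintype.card ι + 1 < Fintype.card κ) (u : ι → ℝ) :
    Integrable (fun Z => u ⬝ᵥ ((Matrix.of Z)ᵀ * Matrix.of Z)⁻¹ *ᵥ u) (gaussianArray κ ι) ∧
    ∫ Z, u ⬝ᵥ ((Matrix.of Z)ᵀ * Matrix.of Z)⁻¹ *ᵥ u ∂(gaussianArray κ ι) =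
      (u ⬝ᵥ u) / ((Fintype.card κ : ℝ) - Fintype.card ι - 1) := by
  have hc' := card_sub_card_sub_one_pos hc
  set c := (Fintype.card κ : ℝ) - Fintype.card ι - 1 with hcdef
  have hae := ae_det_gram_ne_zero hc
  let e : ℕ → ℝ := fun N => 1 / ((N : ℝ) + 1)
  have he0 : ∀ N, 0 < e N := fun N => by positivity
  have he1 : ∀ N, e N ≤ 1 := fun N => by
    rw [div_le_one (by positivity)]; linarith [(Nat.cast_nonneg N : (0 : ℝ) ≤ N)]
  have helim : Tendsto e atTop (𝓝 0) := tendsto_one_div_add_atTop_nhds_zero_nat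
  have hRlim : ∀ Y : Matrix κ ι ℝ, (Yᵀ * Y).det ≠ 0 →
      Tendsto (fun N => ridgeInv (e N) Y) atTop (𝓝 (Yᵀ * Y)⁻¹) :=
    fun Y hY => (tendsto_ridgeInv_zero Y hY).comp helim
  have hvlim : ∀ Y : Matrix κ ι ℝ, (Yᵀ * Y).det ≠ 0 →
      Tendsto (fun N => ridgeInv (e N) Y *ᵥ u) atTop (𝓝 ((Yᵀ * Y)⁻¹ *ᵥ u)) := fun Y hY =>
    ((continuous_id.matrix_mulVec (continuous_const (y := u))).tendsto _).comp (hRlim Y hY)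
  have hqlim : ∀ Y : Matrix κ ι ℝ, (Yᵀ * Y).det ≠ 0 →
      Tendsto (fun N => u ⬝ᵥ ridgeInv (e N) Y *ᵥ u) atTop (𝓝 (u ⬝ᵥ (Yᵀ * Y)⁻¹ *ᵥ u)) :=
    fun Y hY => (((continuous_const (y := u)).dotProduct continuous_id).tendsto _).comp
      (hvlim Y hY)
  have hqnn : ∀ Z : κ → ι → ℝ, ((Matrix.of Z)ᵀ * Matrix.of Z).det ≠ 0 →
      0 ≤ u ⬝ᵥ ((Matrix.of Z)ᵀ * Matrix.of Z)⁻¹ *ᵥ u := fun Z hZ =>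
    (ridgeInv_quadratic_nonneg one_pos _ u).trans (ridgeInv_quadratic_le one_pos _ hZ u)
  -- Fatou's lemma and the uniform bound on the regularised expectations
  have hint : Integrable (fun Z => u ⬝ᵥ ((Matrix.of Z)ᵀ * Matrix.of Z)⁻¹ *ᵥ u)
      (gaussianArray κ ι) := by
    refine ⟨(measurable_gramInv_quadratic u).aestronglyMeasurable, ?_⟩
    rw [hasFiniteIntegral_iff_ofReal (hae.mono fun Z hZ => hqnn Z hZ)]
    have hlim : ∀ᵐ Z ∂(gaussianArray κ ι),
        ENNReal.ofReal (u ⬝ᵥ ((Matrix.of Z)ᵀ * Matrix.of Z)⁻¹ *ᵥ u) =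
          liminf (fun N => ENNReal.ofReal (u ⬝ᵥ ridgeInv (e N) (Matrix.of Z) *ᵥ u)) atTop :=
      hae.mono fun Z hZ => ((ENNReal.tendsto_ofReal (hqlim _ hZ)).liminf_eq).symm
    rw [lintegral_congr_ae hlim]
    refine lt_of_le_of_lt (lintegral_liminf_le fun N =>
      (measurable_ridgeInv_quadratic (he0 N) u).ennreal_ofReal) ?_
    refine lt_of_le_of_lt (b := ENNReal.ofReal ((u ⬝ᵥ u) / c)) ?_ ENNReal.ofReal_lt_top
    refine liminf_le_of_frequently_le' (Frequently.of_forall fun N => ?_)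
    obtain ⟨h1, h2⟩ := integrable_ridgeInv_quadratic hc (he0 N) u
    rw [← ofReal_integral_eq_lintegral_ofReal h1
      (ae_of_all _ fun Z => ridgeInv_quadratic_nonneg (he0 N) _ u)]
    refine ENNReal.ofReal_le_ofReal ?_
    rw [le_div_iff₀ hc', mul_comm]
    exact h2
  refine ⟨hint, ?_⟩
  have hDCT := tendsto_integral_of_dominated_convergence
    (F := fun N Z => haffForm (e N) u (Matrix.of Z))
    (f := fun Z => c * (u ⬝ᵥ ((Matrix.of Z)ᵀ * Matrix.of Z)⁻¹ *ᵥ u)) (μ := gaussianArray κ ι)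
    (fun Z => (c + Fintype.card ι + 2) * (u ⬝ᵥ ((Matrix.of Z)ᵀ * Matrix.of Z)⁻¹ *ᵥ u))
    (fun N => (integral_haffForm (he0 N) u).1.1) (hint.const_mul _)
    (fun N => hae.mono fun Z hZ => ?_) (hae.mono fun Z hZ => ?_)
  · simp only [(integral_haffForm (he0 _) u).2] at hDCT
    have := tendsto_nhds_unique hDCT tendsto_const_nhds
    rw [integral_const_mul] at this
    rw [eq_div_iff hc'.ne', mul_comm]
    exact this
  · have h1 := ridgeInv_quadratic_nonneg (he0 N) (Matrix.of Z) u
    have h2 := trace_ridgeInv_nonneg (he0 N) (Matrix.of Z)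
    have h3 := mul_trace_ridgeInv_le (he0 N) (Matrix.of Z)
    have h4 := mul_normSq_ridgeInv_mulVec_le (he0 N) (Matrix.of Z) u
    have h5 := ridgeInv_quadratic_le (he0 N) (Matrix.of Z) hZ u
    rw [Real.norm_of_nonneg ((mul_nonneg hc'.le h1).trans (haffForm_lower (he0 N) _ u))]
    unfold haffForm
    rw [← hcdef]
    have h6 : e N * (ridgeInv (e N) (Matrix.of Z)).trace * (u ⬝ᵥ ridgeInv (e N) (Matrix.of Z) *ᵥ u)
      ≤ Fintype.card ι * (u ⬝ᵥ ridgeInv (e N) (Matrix.of Z) *ᵥ u) := by gcongr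
    have h7 : e N * (u ⬝ᵥ ridgeInv (e N) (Matrix.of Z) *ᵥ u)
      ≤ 1 * (u ⬝ᵥ ridgeInv (e N) (Matrix.of Z) *ᵥ u) := by gcongr; exact he1 N
    calc _ ≤ (c + Fintype.card ι + 2) * (u ⬝ᵥ ridgeInv (e N) (Matrix.of Z) *ᵥ u) := by linarith
      _ ≤ _ := by gcongr
  · have hq := hqlim _ hZ
    have ht : Tendsto (fun N => (ridgeInv (e N) (Matrix.of Z)).trace) atTop
        (𝓝 (((Matrix.of Z)ᵀ * Matrix.of Z)⁻¹).trace) :=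
      ((continuous_id.matrix_trace).tendsto _).comp (hRlim _ hZ)
    have hv := hvlim _ hZ
    have hvv : Tendsto (fun N => ridgeInv (e N) (Matrix.of Z) *ᵥ u ⬝ᵥ
        ridgeInv (e N) (Matrix.of Z) *ᵥ u) atTop _ :=
      ((continuous_id.dotProduct continuous_id).tendsto _).comp hv
    have := (((hq.const_mul c).add ((helim.mul ht).mul hq)).add (helim.mul hvv)).add
      (helim.mul hq)
    simpa [haffForm] using this

end Limit

/-! ### Entries of the pseudo-inverse of a Gaussian array -/

section Array

variable {ι κ : Type*} [Fintype ι] [Fintype κ]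

lemma measurePreserving_neg_gaussianArray :
    MeasurePreserving (fun Z : κ → ι → ℝ => -Z) (gaussianArray κ ι) (gaussianArray κ ι) := by
  have h1 : MeasurePreserving (fun x : ℝ => -x) (gaussianReal 0 1) (gaussianReal 0 1) :=
    ⟨measurable_neg, by simpa using gaussianReal_map_neg (μ := 0) (v := 1)⟩
  exact measurePreserving_pi _ _ fun _ => measurePreserving_pi _ _ fun _ => h1

lemma measurePreserving_perm_gaussianArray (σ : Equiv.Perm κ) :
    MeasurePreserving (fun (Z : κ → ι → ℝ) k => Z (σ k)) (gaussianArray κ ι)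
      (gaussianArray κ ι) := by
  have h := measurePreserving_piCongrLeft
    (fun _ : κ => Measure.pi fun _ : ι => gaussianReal 0 1) σ.symm
  refine (show (fun (Z : κ → ι → ℝ) k => Z (σ k)) =
    MeasurableEquiv.piCongrLeft (fun _ : κ => ι → ℝ) σ.symm from ?_) ▸ h
  ext Z k : 2
  have := Equiv.piCongrLeft_apply_apply (fun _ : κ => ι → ℝ) σ.symm Z (σ k)
  rw [Equiv.symm_apply_apply] at this
  exact this.symm

variable [DecidableEq ι]

/-- The `k`-th coordinate of `Y (YᵀY)⁻¹ u`. When `YᵀY` is invertible, `Y (YᵀY)⁻¹` is the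
pseudo-inverse of the data matrix `Yᵀ`, whose columns are the samples. -/
noncomputable def pinvCoord (u : ι → ℝ) (k : κ) (Y : Matrix κ ι ℝ) : ℝ :=
  (Y *ᵥ (Yᵀ * Y)⁻¹ *ᵥ u) k

lemma measurable_pinvCoord (u : ι → ℝ) (k : κ) :
    Measurable fun Z : κ → ι → ℝ => pinvCoord u k (Matrix.of Z) := by
  simp only [pinvCoord, mulVec, dotProduct, of_apply]
  refine Finset.measurable_fun_sum _ fun a _ => Measurable.mul (by fun_prop) ?_
  exact Finset.measurable_fun_sum _ fun b _ => (measurable_gramInv a b).mul_const _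

lemma sum_pinvCoord_sq (u : ι → ℝ) {Y : Matrix κ ι ℝ} (hY : (Yᵀ * Y).det ≠ 0) :
    ∑ k, pinvCoord u k Y ^ 2 = u ⬝ᵥ (Yᵀ * Y)⁻¹ *ᵥ u := by
  set w := (Yᵀ * Y)⁻¹ *ᵥ u with hw
  have hu : u = Yᵀ *ᵥ Y *ᵥ w := by
    rw [hw, mulVec_mulVec, mulVec_mulVec, mul_nonsing_inv _ hY.isUnit, one_mulVec]
  conv_rhs => rw [hu]
  rw [mulVec_transpose, ← dotProduct_mulVec]
  simp [pinvCoord, dotProduct, pow_two, hw]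

lemma pinvCoord_neg (u : ι → ℝ) (k : κ) (Y : Matrix κ ι ℝ) :
    pinvCoord u k (-Y) = -pinvCoord u k Y := by
  simp [pinvCoord, neg_mulVec]

lemma pinvCoord_submatrix (u : ι → ℝ) (k : κ) (Y : Matrix κ ι ℝ) (σ : Equiv.Perm κ) :
    pinvCoord u k (Y.submatrix σ id) = pinvCoord u (σ k) Y := by
  have h : (Y.submatrix σ id)ᵀ * Y.submatrix σ id = Yᵀ * Y := by
    rw [transpose_submatrix, submatrix_mul_equiv, submatrix_id_id]
  simp only [pinvCoord, h]
  rfl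

lemma integral_pinvCoord (u : ι → ℝ) (k : κ) :
    ∫ Z, pinvCoord u k (Matrix.of Z) ∂(gaussianArray κ ι) = 0 := by
  have hn := measurePreserving_neg_gaussianArray (ι := ι) (κ := κ)
  have h : ∫ Z, pinvCoord u k (Matrix.of Z) ∂(gaussianArray κ ι) =
      -∫ Z, pinvCoord u k (Matrix.of Z) ∂(gaussianArray κ ι) := by
    conv_lhs => rw [← hn.map_eq]
    rw [integral_map hn.measurable.aemeasurable (measurable_pinvCoord u k).aestronglyMeasurable,
      ← integral_neg]
    congr 1
    ext Z
    exact pinvCoord_neg u k (Matrix.of Z)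
  linarith

variable [DecidableEq κ]

lemma integrable_pinvCoord_sq (hc : Fintype.card ι + 1 < Fintype.card κ) (u : ι → ℝ) (k : κ) :
    Integrable (fun Z => pinvCoord u k (Matrix.of Z) ^ 2) (gaussianArray κ ι) := by
  refine (integral_gramInv_quadratic (κ := κ) hc u).1.mono'
    ((measurable_pinvCoord u k).pow_const 2).aestronglyMeasurable
    ((ae_det_gram_ne_zero hc).mono fun Z hZ => ?_)
  rw [Real.norm_of_nonneg (sq_nonneg _), ← sum_pinvCoord_sq u hZ]
  exact Finset.single_le_sum (f := fun k => pinvCoord u k (Matrix.of Z) ^ 2)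
    (fun _ _ => sq_nonneg _) (Finset.mem_univ k)

/-- The rows of a Gaussian array are exchangeable, so that the second moments of the coordinates
share the mean of the quadratic form `u (YᵀY)⁻¹ u` equally. -/
lemma integral_pinvCoord_sq (hc : Fintype.card ι + 1 < Fintype.card κ) (u : ι → ℝ) (k : κ) :
    ∫ Z, pinvCoord u k (Matrix.of Z) ^ 2 ∂(gaussianArray κ ι) =
      (u ⬝ᵥ u) / (Fintype.card κ * ((Fintype.card κ : ℝ) - Fintype.card ι - 1)) := by
  have hsymm : ∀ l : κ, ∫ Z, pinvCoord u l (Matrix.of Z) ^ 2 ∂(gaussianArray κ ι) =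
      ∫ Z, pinvCoord u k (Matrix.of Z) ^ 2 ∂(gaussianArray κ ι) := by
    intro l
    have hσ := measurePreserving_perm_gaussianArray (ι := ι) (Equiv.swap k l)
    conv_lhs => rw [← hσ.map_eq]
    rw [integral_map hσ.measurable.aemeasurable
      ((measurable_pinvCoord u l).pow_const 2).aestronglyMeasurable]
    congr 1
    ext Z
    have := pinvCoord_submatrix u l (Matrix.of Z) (Equiv.swap k l)
    rw [Equiv.swap_apply_right] at this
    rw [← this]
    rfl
  have hsum : ∑ l, ∫ Z, pinvCoord u l (Matrix.of Z) ^ 2 ∂(gaussianArray κ ι) =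
      (u ⬝ᵥ u) / ((Fintype.card κ : ℝ) - Fintype.card ι - 1) := by
    rw [← integral_finsetSum _ fun l _ => integrable_pinvCoord_sq hc u l,
      ← (integral_gramInv_quadratic hc u).2]
    exact integral_congr_ae ((ae_det_gram_ne_zero hc).mono fun Z hZ => sum_pinvCoord_sq u hZ)
  have hκ : (Fintype.card κ : ℝ) ≠ 0 := by
    have : 0 < Fintype.card κ := by omega
    positivity
  simp only [hsymm, Finset.sum_const, Finset.card_univ, nsmul_eq_mul] at hsum
  rw [mul_comm (Fintype.card κ : ℝ), ← div_div, eq_div_iff hκ, mul_comm]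
  exact hsum

lemma integrable_pinvCoord (hc : Fintype.card ι + 1 < Fintype.card κ) (u : ι → ℝ) (k : κ) :
    Integrable (fun Z => pinvCoord u k (Matrix.of Z)) (gaussianArray κ ι) :=
  ((memLp_two_iff_integrable_sq (measurable_pinvCoord u k).aestronglyMeasurable).2
    (integrable_pinvCoord_sq hc u k)).integrable one_le_two

end Array

/-! ### Transfer to a general covariance matrix -/

lemma isMoorePenrose_of_det_ne_zero {p q : ℕ} (A : Matrix (Fin p) (Fin q) ℝ)
    (hA : (A * Aᵀ).det ≠ 0) : IsMoorePenrose A (Aᵀ * (A * Aᵀ)⁻¹) := by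
  have h : A * (Aᵀ * (A * Aᵀ)⁻¹) = 1 := by
    rw [← Matrix.mul_assoc, mul_nonsing_inv _ hA.isUnit]
  refine ⟨?_, ?_, ?_, ?_⟩
  · rw [h, Matrix.one_mul]
  · rw [Matrix.mul_assoc, h, Matrix.mul_one]
  · rw [h, transpose_one]
  · simp [transpose_mul, transpose_nonsing_inv, Matrix.mul_assoc]

/-- The matrix with prescribed columns. -/
def ofCols {n m : ℕ} (c : Fin m → EuclideanSpace ℝ (Fin n)) : Matrix (Fin n) (Fin m) ℝ :=
  Matrix.of fun a k => c k a

lemma continuous_ofCols {n m : ℕ} :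
    Continuous (ofCols : (Fin m → EuclideanSpace ℝ (Fin n)) → _) := by
  refine continuous_matrix fun a k => ?_
  simp only [ofCols, of_apply]
  fun_prop

lemma measurable_ofCols_pinv {n m : ℕ} (i : Fin m) (j : Fin n) :
    Measurable fun c : Fin m → EuclideanSpace ℝ (Fin n) =>
      ((ofCols c)ᵀ * (ofCols c * (ofCols c)ᵀ)⁻¹) i j := by
  have hA : Continuous fun c : Fin m → EuclideanSpace ℝ (Fin n) => ofCols c * (ofCols c)ᵀ :=
    continuous_ofCols.matrix_mul continuous_ofCols.matrix_transpose
  simp only [inv_def, Ring.inverse_eq_inv', Matrix.mul_smul, Matrix.smul_apply, smul_eq_mul]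
  exact hA.matrix_det.measurable.inv.mul
    ((continuous_ofCols.matrix_transpose.matrix_mul hA.matrix_adjugate).matrix_elem i j).measurable

lemma measurable_toLp_mulVec {n : ℕ} (Q : Matrix (Fin n) (Fin n) ℝ) :
    Measurable fun z : Fin n → ℝ => (WithLp.toLp 2 (Q *ᵥ z) : EuclideanSpace ℝ (Fin n)) := by
  have : Continuous fun z : Fin n → ℝ => Q *ᵥ z := continuous_const.matrix_mulVec continuous_id
  exact ((PiLp.continuous_toLp 2 _).comp this).measurable

open scoped MatrixOrder in
/-- Independent Gaussian columns with covariance `S` are the images of independent standard Gaussian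
vectors under a square root of `S`. -/
lemma exists_pi_multivariateGaussian_eq_map {n : ℕ} (m : ℕ) {S : Matrix (Fin n) (Fin n) ℝ}
    (hS : S.PosSemidef) :
    ∃ Q : Matrix (Fin n) (Fin n) ℝ, Q * Qᵀ = S ∧
      Measure.pi (fun _ : Fin m => multivariateGaussian (0 : EuclideanSpace ℝ (Fin n)) S) =
      (gaussianArray (Fin m) (Fin n)).map (fun Z k => WithLp.toLp 2 (Q *ᵥ Z k)) := by
  refine ⟨CFC.sqrt S, ?_, ?_⟩
  · have := (CFC.sqrt_nonneg S).posSemidef.isHermitian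
    rw [IsHermitian, conjTranspose_eq_transpose_of_trivial] at this
    rw [this]
    exact CFC.sqrt_mul_sqrt_self S hS.nonneg
  have hm := measurable_toLp_mulVec (CFC.sqrt S)
  have h : multivariateGaussian (0 : EuclideanSpace ℝ (Fin n)) S =
      (Measure.pi fun _ : Fin n => gaussianReal 0 1).map
        (fun z => WithLp.toLp 2 (CFC.sqrt S *ᵥ z)) := by
    rw [multivariateGaussian, ← map_pi_eq_stdGaussian, Measure.map_map (by fun_prop) (by fun_prop)]
    congr 1
    ext z : 1
    simp
  have : ∀ k : Fin m, IsProbabilityMeasure ((Measure.pi fun _ : Fin n => gaussianReal 0 1).map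
        (fun z => (WithLp.toLp 2 (CFC.sqrt S *ᵥ z) : EuclideanSpace ℝ (Fin n)))) :=
    fun _ => Measure.isProbabilityMeasure_map hm.aemeasurable
  rw [gaussianArray, Measure.pi_map_pi fun _ => hm.aemeasurable, ← h]

lemma ofCols_mulVec {n m : ℕ} (Q : Matrix (Fin n) (Fin n) ℝ) (Z : Fin m → Fin n → ℝ) :
    ofCols (fun k => WithLp.toLp 2 (Q *ᵥ Z k)) = Q * (Matrix.of Z)ᵀ := by
  ext a k
  simp [ofCols, mul_apply, mulVec, dotProduct]

lemma pinv_ofCols_mulVec {n m : ℕ} {Q : Matrix (Fin n) (Fin n) ℝ} (hQ : Q.det ≠ 0)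
    (Z : Fin m → Fin n → ℝ) (i : Fin m) (j : Fin n) :
    ((ofCols fun k => WithLp.toLp 2 (Q *ᵥ Z k))ᵀ * (ofCols (fun k => WithLp.toLp 2 (Q *ᵥ Z k)) *
      (ofCols fun k => WithLp.toLp 2 (Q *ᵥ Z k))ᵀ)⁻¹) i j =
    pinvCoord (Q⁻¹ *ᵥ Pi.single j 1) i (Matrix.of Z) := by
  have hQT : IsUnit (Qᵀ).det := by rw [det_transpose]; exact hQ.isUnit
  have h : Q * (Matrix.of Z)ᵀ * (Matrix.of Z * Qᵀ) =
      Q * ((Matrix.of Z)ᵀ * Matrix.of Z) * Qᵀ := by simp only [Matrix.mul_assoc]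
  rw [ofCols_mulVec, transpose_mul, transpose_transpose, h, Matrix.mul_inv_rev,
    Matrix.mul_inv_rev, Matrix.mul_assoc (Matrix.of Z), mul_nonsing_inv_cancel_left _ _ hQT,
    pinvCoord, mulVec_mulVec, mulVec_mulVec, mulVec_single_one,
    Matrix.mul_assoc]
  rfl

lemma integrable_and_integral_of_hasLaw_map {Ω Ω' 𝓧 : Type*} [MeasurableSpace Ω]
    [MeasurableSpace Ω'] [MeasurableSpace 𝓧] {P : Measure Ω} {γ : Measure Ω'} {φ : Ω' → 𝓧}
    {Y : Ω → 𝓧} (hY : HasLaw Y (γ.map φ) P) (hφ : AEMeasurable φ γ) {g : 𝓧 → ℝ}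
    (hg : Measurable g) (hi : Integrable (fun z => g (φ z)) γ) :
    Integrable (fun ω => g (Y ω)) P ∧ ∫ ω, g (Y ω) ∂P = ∫ z, g (φ z) ∂γ := by
  have h1 : Integrable g (γ.map φ) := (integrable_map_measure hg.aestronglyMeasurable hφ).2 hi
  refine ⟨?_, ?_⟩
  · rw [← hY.map_eq] at h1
    exact (integrable_map_measure hg.aestronglyMeasurable hY.aemeasurable).1 h1
  · rw [← integral_map hφ hg.aestronglyMeasurable, ← hY.map_eq,
      integral_map hY.aemeasurable hg.aestronglyMeasurable]

end InverseWishart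

open InverseWishart in
theorem theorem1 {Ω : Type*} [MeasurableSpace Ω] (P : Measure Ω) [IsProbabilityMeasure P]
    (n m : ℕ) (hm : n + 3 < m + 1)
    (S : Matrix (Fin n) (Fin n) ℝ) (hS : S.PosDef)
    (X : Ω → Matrix (Fin n) (Fin m) ℝ)
    (hlaw : ∀ k : Fin m, HasLaw (fun ω => euclideanCol (X ω) k)
      (multivariateGaussian (0 : EuclideanSpace ℝ (Fin n)) S) P)
    (hindep : iIndepFun (fun (k : Fin m) (ω : Ω) => euclideanCol (X ω) k) P) :
    HasLaw (fun ω (a b : Fin n) => (X ω * (X ω)ᵀ) a b) (wishart S m) P ∧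
    (∀ (i : Fin m) (j : Fin n),
      Integrable (fun ω => moorePenrose (X ω) i j) P ∧
      ∫ ω, moorePenrose (X ω) i j ∂P = 0 ∧
      Integrable (fun ω => (moorePenrose (X ω) i j) ^ 2) P ∧
      ∫ ω, (moorePenrose (X ω) i j) ^ 2 ∂P =
        S⁻¹ j j / ((m : ℝ) * ((m : ℝ) - (n : ℝ) - 1))) ∧
    (S.IsDiag → ∀ (i : Fin m) (j : Fin n),
      ∫ ω, (moorePenrose (X ω) i j) ^ 2 ∂P =
        1 / (Var[fun ω => X ω j i; P] * ((m : ℝ) * ((m : ℝ) - (n : ℝ) - 1)))) := by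
  have hcols : HasLaw (fun ω k => euclideanCol (X ω) k)
      (Measure.pi fun _ : Fin m => multivariateGaussian (0 : EuclideanSpace ℝ (Fin n)) S) P :=
    hindep.hasLaw_pi hlaw
  have hof : ∀ ω, ofCols (fun k => euclideanCol (X ω) k) = X ω := fun ω => rfl
  have hb : ∀ (i : Fin m) (j : Fin n),
      Integrable (fun ω => moorePenrose (X ω) i j) P ∧
      ∫ ω, moorePenrose (X ω) i j ∂P = 0 ∧
      Integrable (fun ω => (moorePenrose (X ω) i j) ^ 2) P ∧
      ∫ ω, (moorePenrose (X ω) i j) ^ 2 ∂P =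
        S⁻¹ j j / ((m : ℝ) * ((m : ℝ) - (n : ℝ) - 1)) := by
    intro i j
    obtain ⟨Q, hQQ, hmap⟩ := exists_pi_multivariateGaussian_eq_map m hS.posSemidef
    have hQ : Q.det ≠ 0 := fun h0 => hS.det_pos.ne' (by rw [← hQQ, det_mul, h0, zero_mul])
    have hc : Fintype.card (Fin n) + 1 < Fintype.card (Fin m) := by simp; omega
    rw [hmap] at hcols
    have hφ : AEMeasurable (fun (Z : Fin m → Fin n → ℝ) k =>
        (WithLp.toLp 2 (Q *ᵥ Z k) : EuclideanSpace ℝ (Fin n)))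
        (gaussianArray (Fin m) (Fin n)) :=
      (measurable_pi_iff.2 fun k =>
        (measurable_toLp_mulVec Q).comp (measurable_pi_apply k)).aemeasurable
    have hdet : ∀ᵐ ω ∂P, (X ω * (X ω)ᵀ).det ≠ 0 := by
      have hcont : Continuous fun c : Fin m → EuclideanSpace ℝ (Fin n) =>
          (ofCols c * (ofCols c)ᵀ).det :=
        (continuous_ofCols.matrix_mul continuous_ofCols.matrix_transpose).matrix_det
      have hmeas : MeasurableSet {c : Fin m → EuclideanSpace ℝ (Fin n) |
          (ofCols c * (ofCols c)ᵀ).det ≠ 0} := (isOpen_ne_fun hcont continuous_const).measurableSet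
      have h : ∀ᵐ c ∂((gaussianArray (Fin m) (Fin n)).map fun Z k =>
          (WithLp.toLp 2 (Q *ᵥ Z k) : EuclideanSpace ℝ (Fin n))),
          (ofCols c * (ofCols c)ᵀ).det ≠ 0 := by
        rw [ae_map_iff hφ hmeas]
        filter_upwards [ae_det_gram_ne_zero hc] with Z hZ
        rw [ofCols_mulVec, transpose_mul, transpose_transpose, Matrix.mul_assoc,
          ← Matrix.mul_assoc (Matrix.of Z)ᵀ, det_mul, det_mul, det_transpose Q]
        exact mul_ne_zero hQ (mul_ne_zero hZ hQ)
      rw [← hcols.map_eq, ae_map_iff hcols.aemeasurable hmeas] at h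
      exact h
    have hpinv : ∀ᵐ ω ∂P, moorePenrose (X ω) i j = ((X ω)ᵀ * (X ω * (X ω)ᵀ)⁻¹) i j :=
      hdet.mono fun ω hω => by
        rw [(moorePenrose_spec (X ω)).unique (isMoorePenrose_of_det_ne_zero (X ω) hω)]
    set u : Fin n → ℝ := Q⁻¹ *ᵥ Pi.single j 1 with hu
    have huu : u ⬝ᵥ u = S⁻¹ j j := by
      rw [hu, dotProduct_mulVec, ← mulVec_transpose, mulVec_mulVec, transpose_nonsing_inv,
        ← Matrix.mul_inv_rev, hQQ]
      simp
    have hg := measurable_ofCols_pinv (n := n) i j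
    have h1 := integrable_and_integral_of_hasLaw_map hcols hφ hg (by
      simp only [pinv_ofCols_mulVec hQ]
      exact integrable_pinvCoord hc u i)
    have h2 := integrable_and_integral_of_hasLaw_map hcols hφ (hg.pow_const 2) (by
      simp only [pinv_ofCols_mulVec hQ]
      exact integrable_pinvCoord_sq hc u i)
    simp only [pinv_ofCols_mulVec hQ, hof] at h1 h2
    have hpinv2 : ∀ᵐ ω ∂P, moorePenrose (X ω) i j ^ 2 =
        ((X ω)ᵀ * (X ω * (X ω)ᵀ)⁻¹) i j ^ 2 := hpinv.mono fun ω hω => by rw [hω]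
    refine ⟨h1.1.congr (hpinv.mono fun _ h => h.symm), ?_,
      h2.1.congr (hpinv2.mono fun _ h => h.symm), ?_⟩
    · rw [integral_congr_ae hpinv, h1.2, integral_pinvCoord]
    · rw [integral_congr_ae hpinv2, h2.2, integral_pinvCoord_sq hc, huu]
      simp
  refine ⟨?_, hb, ?_⟩
  · have hmeas : Measurable fun (g : Fin m → EuclideanSpace ℝ (Fin n)) (a b : Fin n) =>
        ∑ k, g k a * g k b := by fun_prop
    have hW : HasLaw (fun (g : Fin m → EuclideanSpace ℝ (Fin n)) (a b : Fin n) =>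
        ∑ k, g k a * g k b) (wishart S m)
        (Measure.pi fun _ : Fin m => multivariateGaussian (0 : EuclideanSpace ℝ (Fin n)) S) :=
      ⟨hmeas.aemeasurable, rfl⟩
    exact hW.comp hcols
  · intro hdiag i j
    have hvar : Var[fun ω => X ω j i; P] = S j j := by
      rw [← variance_eval_multivariateGaussian (μ := 0) hS.posSemidef j, ← (hlaw i).map_eq,
        variance_map (by fun_prop) (hlaw i).aemeasurable]
      rfl
    have hinv : S⁻¹ j j = 1 / S j j := by
      have h := congrFun₂ (mul_nonsing_inv S hS.det_pos.ne'.isUnit) j j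
      rw [mul_apply, Finset.sum_eq_single j (fun b _ hb => by rw [hdiag hb.symm, zero_mul])
        (by simp), one_apply_eq] at h
      have hne : S j j ≠ 0 := left_ne_zero_of_mul_eq_one h
      rw [eq_div_iff hne, mul_comm, h]
    rw [(hb i j).2.2.2, hvar, hinv, div_div]
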